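/- **Setting.** An $\omega$-word over an alphabet $\Sigma$ is an infinite sequence of letters of $\Sigma$, and an $\omega$-language is a set of $\omega$-words. For $\omega$-languages $L_i\subseteq\Sigma_i^\omega$, the asynchronous product $L_1\parallel\dots\parallel L_n$ is the set of $\omega$-words $w$ over $\bigcup_i\Sigma_i$ such that, for every $i$, the (finite or infinite) word obtained from $w$ by erasing all letters outside $\Sigma_i$ is a prefix of a word of $L_i$ (an $\omega$-word is a prefix of itself). The shuffle of $\omega$-words $v_1,\dots,v_k$ is the set of $\omega$-words obtained by interleaving them, where some $v_i$ may contribute only a finite (possibly empty) prefix; for an $\omega$-language $L$, let $\between_\infty L$ be the union, over all $k\ge 1$ and all $v_1,\dots,v_k\in L$, of the shuffles of $v_1,\dots,v_k$. Let $\mathcal G$ be a finite set of values, and let $\Sigma_{\mathcal D}=\{r_d(g),w_d(g) : g\in\mathcal G\}$ and $\Sigma_{\mathcal C}=\{r_c(g),w_c(g) : g\in\mathcal G\}$ be the disjoint alphabets of reads and writes of the leader and of the contributors. The store $\mathcal S$ is the set of $\omega$-words over $\Sigma_{\mathcal D}\cup\Sigma_{\mathcal C}$ in which every read of a value $g$ is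 preceded by some write and the last write before it writes $g$. A pushdown machine (PDM) $P=(Q,\Gamma,\delta,q_0)$ over $\Sigma$ has a finite set $Q$ of states with initial state $q_0$, a finite stack alphabet $\Gamma$ with a bottom symbol $\bot\in\Gamma$, and rules $\delta\subseteq Q\times\Sigma\times\Gamma\times Q\times((\Gamma\setminus\{\bot\})\cup\{\mathsf{pop}\})$. Its transitions between configurations $qw$ ($q\in Q$, $w\in\Gamma^*$, topmost symbol first) are $q\gamma w\xrightarrow{a}q'w$ for $(q,a,\gamma,q',\mathsf{pop})\in\delta$ and $q\gamma w\xrightarrow{a}q'\gamma'\gamma w$ for $(q,a,\gamma,q',\gamma')\in\delta$ with $\gamma'\neq\mathsf{pop}$. $L(P)$ is the set of $\omega$-words having an infinite run from $q_0\bot$. A Büchi PDM also has a set $F\subseteq Q$, and its language consists of the $\omega$-words having an infinite run from $q_0\bot$ that visits $F$ infinitely often; a PDM is identified with the Büchi PDM with $F=Q$. For $k\ge 1$, the $k$-restriction $P_k$ of a PDM $P$ is the finite-state machine with states $(q,w)$, $q\in Q$, $w\in\Gamma^*$, $1\le|w|\le k$, with initial state $(q_0,\bot)$, and with a transition $(q,w)\xrightarrow{a}(q',u)$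 between such states iff $P$ has a transition $qw\xrightarrow{a}q'w'$ for some $w'$ whose prefix of length $\min(k,|w'|)$ is $u$. $L(P_k)$ is the set of $\omega$-words having an infinite run from the initial state. For a Büchi PDM $D$ over $\Sigma_{\mathcal D}$, a PDM $C$ over $\Sigma_{\mathcal C}$ with states $Q_C$ and stack alphabet $\Gamma_C$, and $N\ge1$, consider the equivalence $$\bigl(L(D)\parallel\mathcal S\parallel\between_\infty L(C)\bigr)\neq\emptyset\iff\bigl(L(D)\parallel\mathcal S\parallel\between_\infty L(C_N)\bigr)\neq\emptyset.\qquad(\dagger)$$ **Theorem (Reduction Theorem).** 1. For every finite $\mathcal G$, every Büchi PDM $D$ and every PDM $C$, $(\dagger)$ holds for $N=2|Q_C|^2|\Gamma_C|+1$. 2. The bound is asymptotically tight: there are a real $c>0$ and an $n_0\in\mathbb N$ such that for all integers $n,m\ge n_0$ there are a finite set $\mathcal G$, a PDM $D$ (all states accepting) and a PDM $C$ with $|Q_C|=n$ and $|\Gamma_C|=m$, such that each value of $\mathcal G$ is read or written in some word of $L(D)\cup L(C)$, and every $N\ge1$ for which $(\dagger)$ holds satisfies $N\ge c\,n^2m$.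 -/

import Mathlib

open Set Filter

/-! ### Operations on ω-languages

An ω-word over `A` is a function `ℕ → A`; an ω-language is a set of ω-words. -/

/-- `ProjIsPrefix p w x`: the projection of the ω-word `w` (erase the letters sent to `none` by `p`,
rename the others along `p`), which is a finite or an infinite word, is a prefix of the ω-word `x`
(an ω-word counts as a prefix of itself). Equivalently, the projection of every finite prefix
of `w` is a prefix of `x`. -/
def ProjIsPrefix {A B : Type*} (p : A → Option B) (w : ℕ → A) (x : ℕ → B) : Prop :=
  ∀ n : ℕ, ((List.range n).map w).filterMap p <+: (List.range n).map x

/-- Asynchronous product of `L₁` (over the alphabet `A₁`) and `L₂` (over `A₂`): the ω-words over `A`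
whose projections to the two alphabets are prefixes of words of `L₁` and `L₂`. -/
def asyncProd {A A₁ A₂ : Type*} (p₁ : A → Option A₁) (p₂ : A → Option A₂)
    (L₁ : Set (ℕ → A₁)) (L₂ : Set (ℕ → A₂)) : Set (ℕ → A) :=
  {w | (∃ x ∈ L₁, ProjIsPrefix p₁ w x) ∧ (∃ y ∈ L₂, ProjIsPrefix p₂ w y)}

/-- The interleavings of `k` ω-words: `σ t` says which word supplies the letter at position `t`,
and it supplies its next letter. Some words may contribute only a finite prefix. -/
def shuffle {A : Type*} {k : ℕ} (v : Fin k → ℕ → A) : Set (ℕ → A) :=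
  {z | ∃ σ : ℕ → Fin k, ∀ t : ℕ, z t = v (σ t) (Nat.count (fun s => σ s = σ t) t)}

/-- The shuffle of `k` copies of the ω-language `L`. -/
def shufflePow {A : Type*} (k : ℕ) (L : Set (ℕ → A)) : Set (ℕ → A) :=
  {z | ∃ v : Fin k → ℕ → A, (∀ i, v i ∈ L) ∧ z ∈ shuffle v}

/-- The union over `k ≥ 1` of the shuffles of `k` copies of `L`. -/
def shuffleInf {A : Type*} (L : Set (ℕ → A)) : Set (ℕ → A) :=
  {z | ∃ k : ℕ, 1 ≤ k ∧ z ∈ shufflePow k L}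

/-! ### Non-atomic networks -/

inductive RWKind
  | read
  | write

/-- The read-write alphabet over the global values `G`, for the leader as well as for the
contributors. -/
abbrev RW (G : Type*) := RWKind × G

/-- The letters of a network, the disjoint union of the alphabets of the leader (`inl`) and of the
contributors (`inr`). -/
abbrev NetLetter (G : Type*) := RW G ⊕ RW G

/-- The steps of an atomic register (`none`: not initialised). -/
inductive RegisterStep {G : Type*} : Option G → RW G → Option G → Prop
  | write (x : Option G) (g : G) : RegisterStep x (RWKind.write, g) (some g)
  | read (g : G) : RegisterStep (some g) (RWKind.read, g) (some g)

/-- The store: the infinite sequences of reads and writes, by anyone, that an atomic register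
supports, starting uninitialised. -/
def store (G : Type*) : Set (ℕ → NetLetter G) :=
  {s | ∃ reg : ℕ → Option G, reg 0 = none ∧
    ∀ i, RegisterStep (reg i) (Sum.elim id id (s i)) (reg (i + 1))}

/-- The network with leader `D` and contributor `C`, that is, the asynchronous product of `D`,
the store, and the shuffles of finitely many (at least one) copies of `C`. -/
def network {G : Type*} (D C : Set (ℕ → RW G)) : Set (ℕ → NetLetter G) :=
  asyncProd some Sum.getRight? (asyncProd Sum.getLeft? some D (store G)) (shuffleInf C)

/-! ### Finite-state and pushdown machines -/

/-- Finite-state machines over the alphabet `A`. -/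
structure FSM (Q : Type*) [Finite Q] (A : Type*) where
  trans : Set (Q × A × Q)
  init : Q

/-- The ω-words that have an infinite run. -/
def FSM.language {Q A : Type*} [Finite Q] (M : FSM Q A) : Set (ℕ → A) :=
  {v | ∃ q : ℕ → Q, q 0 = M.init ∧ ∀ i, (q i, v i, q (i + 1)) ∈ M.trans}

/-- Pushdown machines with states `Q` and stack alphabet `Γ` (containing the bottom symbol `bot`)
over the alphabet `A`. A rule `(q, a, γ, q', x)` applies in state `q` with topmost symbol `γ`; it
pops `γ` if `x = none`, and pushes `γ' ≠ bot` on top of `γ` if `x = some γ'`. -/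
structure PDM (Q Γ A : Type*) [Finite Q] [Finite Γ] where
  bot : Γ
  rules : Set (Q × A × Γ × Q × Option {γ : Γ // γ ≠ bot})
  init : Q

/-- Transitions between configurations `(q, w)`; the head of the list `w` is the top of the stack. -/
inductive PDM.Step {Q Γ A : Type*} [Finite Q] [Finite Γ] (P : PDM Q Γ A) :
    Q × List Γ → A → Q × List Γ → Prop
  | pop {q : Q} {a : A} {γ : Γ} {q' : Q} (w : List Γ) (h : (q, a, γ, q', none) ∈ P.rules) :
      PDM.Step P (q, γ :: w) a (q', w)
  | push {q : Q} {a : A} {γ : Γ} {q' : Q} {γ' : {γ : Γ // γ ≠ P.bot}} (w : List Γ)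
      (h : (q, a, γ, q', some γ') ∈ P.rules) :
      PDM.Step P (q, γ :: w) a (q', γ'.1 :: γ :: w)

/-- `c` is an infinite run on the ω-word `v`. -/
def PDM.IsRun {Q Γ A : Type*} [Finite Q] [Finite Γ] (P : PDM Q Γ A) (v : ℕ → A)
    (c : ℕ → Q × List Γ) : Prop :=
  c 0 = (P.init, [P.bot]) ∧ ∀ i, P.Step (c i) (v i) (c (i + 1))

/-- The ω-words that have an infinite run. -/
def PDM.language {Q Γ A : Type*} [Finite Q] [Finite Γ] (P : PDM Q Γ A) : Set (ℕ → A) :=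
  {v | ∃ c, P.IsRun v c}

/-- Pushdown machines with a Büchi acceptance condition. -/
structure BuchiPDM (Q Γ A : Type*) [Finite Q] [Finite Γ] extends PDM Q Γ A where
  accepting : Set Q

/-- The ω-words that have a run visiting accepting states infinitely often. -/
def BuchiPDM.language {Q Γ A : Type*} [Finite Q] [Finite Γ] (P : BuchiPDM Q Γ A) :
    Set (ℕ → A) :=
  {v | ∃ c, P.toPDM.IsRun v c ∧ ∃ᶠ i in atTop, (c i).1 ∈ P.accepting}

/-- Stack contents of length between `1` and `k`. -/
abbrev BddStack (Γ : Type*) (k : ℕ) := {w : List Γ // 1 ≤ w.length ∧ w.length ≤ k}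

instance BddStack.instFinite (Γ : Type*) [Finite Γ] (k : ℕ) : Finite (BddStack Γ k) :=
  ((List.finite_length_le Γ k).subset fun _ h => h.2).to_subtype

/-- The `k`-restriction of a pushdown machine (`k ≥ 1`): the states are the configurations with
stack content of length between `1` and `k`, and every transition from such a configuration is
followed by cutting the stack content to its `k` topmost symbols. -/
def PDM.restriction {Q Γ A : Type*} [Finite Q] [Finite Γ] (P : PDM Q Γ A) (k : ℕ) (hk : 1 ≤ k) :
    FSM (Q × BddStack Γ k) A where
  trans := {τ | ∃ w' : List Γ,
    P.Step (τ.1.1, τ.1.2.1) τ.2.1 (τ.2.2.1, w') ∧ τ.2.2.2.1 = w'.take k}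
  init := (P.init, ⟨[P.bot], le_refl 1, hk⟩)

/-!
Both parts rest on a description of the network that does not mention shuffles (`NetRun`,
`exists_netRun_of_network_nonempty`, `NetRun.network_nonempty`). Time is divided into instants, and
at each instant everybody who acts reads or writes the same register value. One principal actor
accounts for this value, and the others may act right after it, because reading or rewriting the
value that the register holds anyway changes nothing. So additional contributors that follow an
existing contributor, leaving out some of its letters, come for free.

**Upper bound.** Fix a run of the network whose contributors have unbounded stacks.

* A stretch of a contributor's run that pushes a symbol and pops it again is a tree of nested
  pushes and pops with nodes (state, symbol, state) (`PopTree`). If a node is nested in an equal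
  one, what lies between them can be cut out. With one letter marked, cutting on the path to the
  mark and in the trees hanging off it leaves a height of at most `2|Q|²|Γ|`
  (`PopTree.exists_bdd_marked`). An infinite run has infinitely many instants after which its stack
  never gets lower, and two of them agree in state and topmost symbol. Hence every letter of a word
  of `C` occurs in an ultimately periodic word of the restriction whose preperiod and first
  period are a subword of the given word (`PDM.exists_periodic_subword`).
* The leader's run, a Büchi pushdown run, can be looped between two suitable instants `T₀ < T₁`
  (`BuchiPDM.exists_loop_times`). These are chosen such that every register value that is in use
  infinitely often is in use in `[T₀, T₁)`. Then any word over the letters with these values can be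
  performed inside the loop, one letter per iteration. Therefore finitely many contributors
  with periodic words of low height, started one iteration apart, can perform one given action of an
  original contributor in every iteration (`exists_helpers`). The actions before `T₁` are finite in
  number, so finitely many contributors suffice (`network_restriction_nonempty`).

**Lower bound.** The contributor `counterPDM` has `k` states for pushing, `k` states for popping and
`M` stack symbols besides the bottom. It pushes with period `(M - 1) * k + 1`, a number that it can
count with its states and its topmost symbol together. While popping it counts the periods, and it writes the value
`2` if it finds the bottom symbol after exactly `k` of them, hence only with a stack of height
`((M - 1) * k + 1) * k`. If this exceeds `N`, the restriction has lost the bottom symbol by then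
(`counterPDM_restriction_val_ne`). The leader writes a finite script, which contains what one
contributor has to read, and then waits for the value `2`. No contributor can go on forever while
the register does not change, so without the value `2` the network stops.
-/

/-! ### Labelled paths and periodic runs -/

section Paths

variable {σ τ A : Type*}

/-- `LPath S c l c'`: the labelled transition relation `S` has a finite path from `c` to `c'` with
sequence of labels `l`. -/
inductive LPath (S : σ → A → σ → Prop) : σ → List A → σ → Prop
  | nil (c : σ) : LPath S c [] c
  | cons {c c' c'' : σ} {a : A} {l : List A} :
      S c a c' → LPath S c' l c'' → LPath S c (a :: l) c''

theorem LPath.append {S : σ → A → σ → Prop} {c c' c'' : σ} {l l' : List A}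
    (h : LPath S c l c') (h' : LPath S c' l' c'') : LPath S c (l ++ l') c'' := by
  induction h with
  | nil => exact h'
  | cons hs _ ih => exact .cons hs (ih h')

theorem LPath.single {S : σ → A → σ → Prop} {c c' : σ} {a : A} (h : S c a c') :
    LPath S c [a] c' := .cons h (.nil _)

theorem LPath.exists_states {S : σ → A → σ → Prop} {c c' : σ} {l : List A}
    (h : LPath S c l c') : ∃ s : ℕ → σ, s 0 = c ∧ s l.length = c' ∧
      ∀ i (hi : i < l.length), S (s i) l[i] (s (i + 1)) := by
  induction h with
  | nil c => exact ⟨fun _ => c, rfl, rfl, by simp⟩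
  | @cons c c' c'' a l hs _ ih =>
    obtain ⟨s, h0, h1, h2⟩ := ih
    refine ⟨fun n => Nat.casesOn n c s, rfl, by simpa using h1, ?_⟩
    rintro (_ | i) hi
    · simpa [h0] using hs
    · simpa using h2 i (by simpa using hi)

/-- A simulation lifts infinite runs. -/
theorem exists_run_of_simulation {S : σ → A → σ → Prop} {S' : τ → A → τ → Prop}
    {R : σ → τ → Prop} (hR : ∀ {c a c' d}, S c a c' → R c d → ∃ d', S' d a d' ∧ R c' d')
    {r : ℕ → σ} {v : ℕ → A} (hr : ∀ i, S (r i) (v i) (r (i + 1))) {d : τ} (h0 : R (r 0) d) :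
    ∃ r' : ℕ → τ, r' 0 = d ∧ ∀ i, S' (r' i) (v i) (r' (i + 1)) ∧ R (r i) (r' i) := by
  choose! f hf using fun (i : ℕ) (d : τ) => hR (d := d) (hr i)
  let r' : ℕ → τ := fun n => Nat.rec d (fun i d => f i d) n
  have h : ∀ i, R (r i) (r' i) := by
    intro i
    induction i with
    | zero => exact h0
    | succ i ih => exact (hf i _ ih).2
  exact ⟨r', rfl, fun i => ⟨(hf i _ (h i)).1, h i⟩⟩

/-- The index sequence `0, 1, …, b - 1, a, a + 1, …, b - 1, a, …` that repeats the interval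
`[a, b)` forever. For `a = b` it is the identity. -/
def loopIdx (a b : ℕ) : ℕ → ℕ
  | 0 => 0
  | n + 1 => if loopIdx a b n + 1 = b then a else loopIdx a b n + 1

theorem loopIdx_self (a n : ℕ) : loopIdx a a n = n := by
  induction n with
  | zero => rfl
  | succ n ih => simp only [loopIdx, ih]; split_ifs <;> omega

theorem loopIdx_of_lt {a b n : ℕ} (h : n < b) : loopIdx a b n = n := by
  induction n with
  | zero => rfl
  | succ n ih => simp only [loopIdx, ih (by omega)]; split_ifs <;> omega

theorem loopIdx_end {a b : ℕ} (h : a ≤ b) : loopIdx a b b = a := by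
  obtain _ | b := b
  · simp only [loopIdx]; omega
  · simp [loopIdx, loopIdx_of_lt (Nat.lt_succ_self b)]

theorem loopIdx_lt {a b : ℕ} (h : a < b) (n : ℕ) : loopIdx a b n < b := by
  induction n with
  | zero => simp only [loopIdx]; omega
  | succ n ih => simp only [loopIdx]; split_ifs <;> omega

theorem le_loopIdx {a b n : ℕ} (hab : a ≤ b) (h : a ≤ n) : a ≤ loopIdx a b n := by
  induction n, h using Nat.le_induction with
  | base =>
    rcases hab.lt_or_eq with h | rfl
    · rw [loopIdx_of_lt h]
    · rw [loopIdx_self]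
  | succ n _ ih => simp only [loopIdx]; split_ifs <;> omega

theorem loopIdx_add_period {a b n : ℕ} (hab : a < b) (h : a ≤ n) :
    loopIdx a b (n + (b - a)) = loopIdx a b n := by
  induction n, h using Nat.le_induction with
  | base => rw [Nat.add_sub_cancel' hab.le, loopIdx_end hab.le, loopIdx_of_lt hab]
  | succ n _ ih => rw [Nat.add_right_comm]; simp only [loopIdx, ih]

theorem loopIdx_add_mul_period {a b n : ℕ} (hab : a < b) (h : a ≤ n) (k : ℕ) :
    loopIdx a b (n + k * (b - a)) = loopIdx a b n := by
  induction k with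
  | zero => simp
  | succ k ih => rw [Nat.succ_mul, ← Nat.add_assoc, loopIdx_add_period hab (by omega), ih]

theorem eq_add_mul_period_of_loopIdx_eq {a b s : ℕ} (hab : a < b) (_hs : a ≤ s) :
    ∀ n, loopIdx a b n = s → ∃ k, n = s + k * (b - a) := by
  intro n
  induction n using Nat.strong_induction_on with
  | _ n ih =>
    intro h
    rcases lt_or_ge n b with hn | hn
    · exact ⟨0, by rw [loopIdx_of_lt hn] at h; omega⟩
    · have h1 := loopIdx_add_period hab (n := n - (b - a)) (by omega)
      rw [Nat.sub_add_cancel (by omega), h] at h1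
      obtain ⟨k, hk⟩ := ih (n - (b - a)) (by omega) h1.symm
      exact ⟨k + 1, by rw [Nat.succ_mul]; omega⟩

/-- From any position of the periodic part, every position of the period is reached within one
period. -/
theorem exists_loopIdx_add_eq {a b t : ℕ} (hat : a ≤ t) (htb : t < b) {s : ℕ} (hs : a ≤ s) :
    ∃ o < b - a, loopIdx a b (s + o) = t := by
  induction s, hs using Nat.le_induction with
  | base => exact ⟨t - a, by omega, by rw [Nat.add_sub_cancel' hat, loopIdx_of_lt htb]⟩
  | succ s hs ih =>
    obtain ⟨_ | o, ho, h⟩ := ih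
    · refine ⟨b - a - 1, by omega, ?_⟩
      rw [show s + 1 + (b - a - 1) = s + (b - a) by omega, loopIdx_add_period (by omega) hs]
      exact h
    · exact ⟨o, by omega, by rw [← h]; congr 1; omega⟩

theorem loopIdx_run {S : σ → A → σ → Prop} {s : ℕ → σ} {v : ℕ → A} {a b : ℕ}
    (hab : a < b) (hs : ∀ i < b, S (s i) (v i) (s (i + 1))) (hb : s b = s a) (n : ℕ) :
    S (s (loopIdx a b n)) (v (loopIdx a b n)) (s (loopIdx a b (n + 1))) := by
  have h := hs _ (loopIdx_lt hab n)
  simp only [loopIdx]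
  split_ifs with hn
  · rwa [hn, hb] at h
  · exact h

end Paths

/-! ### Counting and projections -/

section Count

theorem count_count_comp (A B : ℕ → Prop) [DecidablePred A] [DecidablePred B]
    [DecidablePred fun s => A s ∧ B (Nat.count A s)] (n : ℕ) :
    Nat.count B (Nat.count A n) = Nat.count (fun s => A s ∧ B (Nat.count A s)) n := by
  induction n with
  | zero => simp
  | succ n ih =>
    rw [Nat.count_succ A, Nat.count_succ (fun s => A s ∧ B (Nat.count A s)), ← ih]
    by_cases h : A n <;> simp [h, Nat.count_succ]

/-- Counting after a relabelling of time that is increasing where it matters. -/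
theorem count_image {a : ℕ → Prop} [DecidablePred a] {T : ℕ → ℕ}
    [DecidablePred fun s => ∃ t, a t ∧ T t = s]
    (hT : ∀ t t', a t → a t' → t < t' → T t < T t') {t : ℕ} (ht : a t) :
    Nat.count (fun s => ∃ t, a t ∧ T t = s) (T t) = Nat.count a t := by
  rw [Nat.count_eq_card_filter_range, Nat.count_eq_card_filter_range]
  symm
  refine Finset.card_bij (fun i _ => T i) ?_ ?_ ?_
  · intro i hi
    simp only [Finset.mem_filter, Finset.mem_range] at hi ⊢
    exact ⟨hT _ _ hi.2 ht hi.1, i, hi.2, rfl⟩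
  · intro i hi j hj hij
    simp only [Finset.mem_filter, Finset.mem_range] at hi hj
    rcases lt_trichotomy i j with h | h | h
    · exact absurd hij (hT _ _ hi.2 hj.2 h).ne
    · exact h
    · exact absurd hij (hT _ _ hj.2 hi.2 h).ne'
  · intro s hs
    simp only [Finset.mem_filter, Finset.mem_range] at hs
    obtain ⟨hs, i, hi, rfl⟩ := hs
    refine ⟨i, ?_, rfl⟩
    simp only [Finset.mem_filter, Finset.mem_range]
    refine ⟨?_, hi⟩
    by_contra h
    rcases (not_lt.1 h).lt_or_eq with h | rfl
    · exact absurd (hT _ _ ht hi h) (by omega)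
    · omega

theorem exists_of_lt_count {a : ℕ → Prop} [DecidablePred a] {j n : ℕ} (h : j < Nat.count a n) :
    ∃ t < n, a t ∧ Nat.count a t = j := by
  induction n with
  | zero => simp at h
  | succ n ih =>
    by_cases hj : j < Nat.count a n
    · obtain ⟨t, h1, h2⟩ := ih hj
      exact ⟨t, by omega, h2⟩
    · rw [Nat.count_succ] at h
      split_ifs at h with ha
      · exact ⟨n, by omega, ha, by omega⟩
      · omega

theorem lt_of_count_lt {a : ℕ → Prop} [DecidablePred a] {s t : ℕ}
    (h : Nat.count a s < Nat.count a t) : s < t := by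
  by_contra hst
  exact absurd (Nat.count_monotone a (not_lt.1 hst)) (by omega)

theorem exists_count_eq_of_frequently {a : ℕ → Prop} [DecidablePred a] (h : ∃ᶠ t in atTop, a t)
    (j : ℕ) : ∃ t, a t ∧ Nat.count a t = j := by
  have hlt : ∀ j, ∃ n, j < Nat.count a n := by
    intro j
    induction j with
    | zero =>
      obtain ⟨t, _, ht⟩ := frequently_atTop.1 h 0
      exact ⟨t + 1, by simp [Nat.count_succ, ht]⟩
    | succ j ih =>
      obtain ⟨n, hn⟩ := ih
      obtain ⟨t, htn, ht⟩ := frequently_atTop.1 h n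
      refine ⟨t + 1, ?_⟩
      have := Nat.count_monotone a htn
      simp only [Nat.count_succ, ht, if_true]
      omega
  obtain ⟨n, hn⟩ := hlt j
  obtain ⟨t, _, ht⟩ := exists_of_lt_count hn
  exact ⟨t, ht⟩

theorem filterMap_range_eq {A B : Type*} {p : A → Option B} {w : ℕ → A} {x : ℕ → B} (n : ℕ)
    (h : ∀ i < n, ∀ y, p (w i) = some y → x (Nat.count (fun i => (p (w i)).isSome) i) = y) :
    ((List.range n).map w).filterMap p =
      (List.range (Nat.count (fun i => (p (w i)).isSome) n)).map x := by
  induction n with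
  | zero => simp
  | succ n ih =>
    rw [List.range_succ, List.map_append, List.filterMap_append,
      ih fun i hi => h i (by omega), Nat.count_succ]
    cases hp : p (w n) with
    | none => simp [hp]
    | some y => simp [hp, List.range_succ, h n (by omega) y hp]

theorem projIsPrefix_iff {A B : Type*} {p : A → Option B} {w : ℕ → A} {x : ℕ → B} :
    ProjIsPrefix p w x ↔
      ∀ i y, p (w i) = some y → x (Nat.count (fun i => (p (w i)).isSome) i) = y := by
  constructor
  · intro h i
    induction i using Nat.strong_induction_on with
    | _ i ih =>
      intro y hy
      have h1 := h (i + 1)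
      rw [List.range_succ, List.map_append, List.filterMap_append, filterMap_range_eq i ih,
        ← List.range_succ] at h1
      set c := Nat.count (fun i => (p (w i)).isSome) i
      have h2 := List.IsPrefix.getElem h1 (i := c) (by simp [hy])
      simp [hy] at h2
      exact h2.symm
  · intro h n
    rw [filterMap_range_eq n fun i _ => h i]
    refine List.IsPrefix.map _ ?_
    obtain ⟨d, hd⟩ := Nat.exists_eq_add_of_le
      (Nat.count_le (p := fun i => (p (w i)).isSome) (n := n))
    generalize Nat.count (fun i => ((p (w i)).isSome : Prop)) n = c at hd ⊢
    rw [hd, List.range_add]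
    exact List.prefix_append _ _

/-- An infinitely repeated event occurs infinitely often together with one fixed value of a
finitely valued observation. -/
theorem exists_frequently_eq {K : Type*} [Finite K] {p : ℕ → Prop} (h : ∃ᶠ n in atTop, p n)
    (f : ℕ → K) : ∃ k, ∃ᶠ n in atTop, p n ∧ f n = k := by
  by_contra hk
  simp only [not_exists, not_frequently] at hk
  have := eventually_all.2 hk
  obtain ⟨n, hn, hn'⟩ := (h.and_eventually this).exists
  exact hn' (f n) ⟨hn, rfl⟩

end Count

/-! ### Networks as synchronised runs -/

/-- The register holds the value `reg t` already when instant `t` begins. -/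
def Held {G : Type*} (reg : ℕ → G) (t : ℕ) : Prop := ∃ s, t = s + 1 ∧ reg s = reg t

open Classical in
/-- A synchronised run of a leader on `x` and contributors on the words `v j`. At every instant `t`
one register value `reg t` is in use. The leader and each contributor perform at most one letter
per instant, and all these letters carry the value `reg t`. A principal actor, which is the leader
if it acts, justifies that value: it writes it, or it reads it while the register already holds it.
All other actors at `t` come right after the principal one, so they may read or write freely. -/
structure NetRun {G J : Type*} (x : ℕ → RW G) (v : J → ℕ → RW G) where
  reg : ℕ → G
  lead : ℕ → Prop
  act : J → ℕ → Prop
  lead_val : ∀ t, lead t → (x (Nat.count lead t)).2 = reg t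
  lead_read : ∀ t, lead t → (x (Nat.count lead t)).1 = RWKind.read → Held reg t
  act_val : ∀ j t, act j t → (v j (Nat.count (act j) t)).2 = reg t
  covered : ∀ t, ¬ lead t → ∃ j, act j t ∧
    ((v j (Nat.count (act j) t)).1 = RWKind.read → Held reg t)

section NetRun

variable {G : Type*}

theorem RegisterStep.eq_some {r r' : Option G} {l : RW G} (h : RegisterStep r l r') :
    r' = some l.2 := by
  cases h <;> rfl

theorem RegisterStep.eq_of_read {r r' : Option G} {l : RW G} (h : RegisterStep r l r')
    (hl : l.1 = RWKind.read) : r = some l.2 := by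
  cases h with
  | write => cases hl
  | read => rfl

theorem RegisterStep.mk {r : Option G} {l : RW G} (h : l.1 = RWKind.read → r = some l.2) :
    RegisterStep r l (some l.2) := by
  obtain ⟨_ | _, g⟩ := l
  · rw [h rfl]; exact .read g
  · exact .write r g

open Classical in
theorem exists_netRun_of_network_nonempty {D L : Set (ℕ → RW G)} (h : (network D L).Nonempty) :
    ∃ k : ℕ, 1 ≤ k ∧ ∃ x ∈ D, ∃ v : Fin k → ℕ → RW G, (∀ j, v j ∈ L) ∧ Nonempty (NetRun x v) := by
  obtain ⟨u, ⟨u', ⟨⟨x, hx, hxu⟩, ⟨u'', ⟨rg, hrg0, hrg⟩, hu''⟩⟩, hu'⟩, z, ⟨k, hk, v, hv, σ, hσ⟩,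
    hz⟩ := h
  rw [projIsPrefix_iff] at hxu hu'' hu' hz
  have e1 : u' = u := by
    funext i
    simpa [Nat.count_true] using hu' i (u i) rfl
  subst e1
  have e2 : u'' = u' := by
    funext i
    simpa [Nat.count_true] using hu'' i (u' i) rfl
  subst e2
  refine ⟨k, hk, x, hx, v, hv, ⟨?_⟩⟩
  have hsome : ∀ t, rg (t + 1) = some (Sum.elim id id (u'' t)).2 := fun t => (hrg t).eq_some
  have hheld : ∀ t, (Sum.elim id id (u'' t)).1 = RWKind.read →
      Held (fun t => (Sum.elim id id (u'' t)).2) t := by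
    intro t ht
    have h1 := (hrg t).eq_of_read ht
    obtain _ | t := t
    · rw [hrg0] at h1; cases h1
    · rw [hsome] at h1
      exact ⟨t, rfl, Option.some.inj h1⟩
  have hlead : ∀ t, ((u'' t).getLeft?).isSome →
      x (Nat.count (fun t => ((u'' t).getLeft?).isSome) t) = Sum.elim id id (u'' t) := by
    intro t ht
    cases hu : u'' t with
    | inl d => simpa using hxu t d (by simp [hu])
    | inr d => simp [hu] at ht
  have hcon : ∀ t, ((u'' t).getRight?).isSome →
      z (Nat.count (fun t => ((u'' t).getRight?).isSome) t) = Sum.elim id id (u'' t) := by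
    intro t ht
    cases hu : u'' t with
    | inl d => simp [hu] at ht
    | inr d => simpa using hz t d (by simp [hu])
  let R : ℕ → Prop := fun t => ((u'' t).getRight?).isSome
  have hact : ∀ j t, (R t ∧ σ (Nat.count R t) = j) →
      v j (Nat.count (fun t => R t ∧ σ (Nat.count R t) = j) t) = Sum.elim id id (u'' t) := by
    rintro j t ⟨h1, h2⟩
    subst h2
    rw [← hcon t h1, hσ]
    congr 1
    convert (count_count_comp R (fun c => σ c = σ (Nat.count R t)) t).symm
  exact {
    reg := fun t => (Sum.elim id id (u'' t)).2
    lead := fun t => ((u'' t).getLeft?).isSome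
    act := fun j t => R t ∧ σ (Nat.count R t) = j
    lead_val := fun t ht => by rw [← hlead t ht]; congr!
    lead_read := fun t ht h => hheld t (by rw [← hlead t ht, ← h]; congr!)
    act_val := fun j t ht => by rw [← hact j t ht]; congr!
    covered := fun t ht => by
      have hR : R t := by
        cases hu : u'' t with
        | inl d => simp [hu] at ht
        | inr d => simp [R, hu]
      refine ⟨_, ⟨hR, rfl⟩, fun h => hheld t ?_⟩
      rw [← hact _ t ⟨hR, rfl⟩, ← h]; congr! }

open Classical in
/-- Words of the network from a sequence of events, some of which may be idle. Event `some none` is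
a letter of the leader, event `some (some j)` one of contributor `j`. -/
theorem network_nonempty_of_events {D L : Set (ℕ → RW G)} {k : ℕ} (hk : 1 ≤ k) {x : ℕ → RW G}
    (hx : x ∈ D) {v : Fin k → ℕ → RW G} (hv : ∀ j, v j ∈ L)
    (e : ℕ → Option (Option (Fin k))) (he0 : (e 0).isSome) (he : ∃ᶠ s in atTop, (e s).isSome)
    (rg : ℕ → Option G) (hrg0 : rg 0 = none)
    (hidle : ∀ s, e s = none → rg (s + 1) = rg s)
    (hlead : ∀ s, e s = some none →
      RegisterStep (rg s) (x (Nat.count (fun s => e s = some none) s)) (rg (s + 1)))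
    (hact : ∀ s j, e s = some (some j) →
      RegisterStep (rg s) (v j (Nat.count (fun s => e s = some (some j)) s)) (rg (s + 1))) :
    (network D L).Nonempty := by
  let A : ℕ → Prop := fun s => (e s).isSome
  have hA : (Set.ofPred A).Infinite := Nat.frequently_atTop_iff_infinite.1 he
  let ν := Nat.nth A
  have hν : ∀ i, A (ν i) := Nat.nth_mem_of_infinite hA
  have hνmono : StrictMono ν := Nat.nth_strictMono hA
  have hcν : ∀ i, Nat.count A (ν i) = i := Nat.count_nth_of_infinite hA
  have hνc : ∀ s, A s → ν (Nat.count A s) = s := fun s hs => Nat.nth_count hs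
  have hν0 : ν 0 = 0 := by
    have := hνc 0 he0
    simpa using this
  -- the register is constant between consecutive events
  have hgap : ∀ i s, ν i + 1 ≤ s → s ≤ ν (i + 1) → rg s = rg (ν i + 1) := by
    intro i s hs
    induction s, hs using Nat.le_induction with
    | base => intro _; rfl
    | succ s hs ih =>
      intro h
      rw [← ih (by omega), hidle]
      by_contra hne
      have hAs : A s := Option.isSome_iff_ne_none.2 hne
      have := Nat.le_nth_of_lt_nth_succ (p := A) (k := i) (a := s)
        (show s < ν (i + 1) by omega) hAs
      change s ≤ ν i at this
      omega
  have hcnt : ∀ (B : ℕ → Prop) [DecidablePred B], (∀ s, B s → A s) → ∀ i,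
      Nat.count (fun i => B (ν i)) i = Nat.count B (ν i) := by
    intro B _ hB i
    conv_lhs => rw [← hcν i]
    rw [count_count_comp A (fun i => B (ν i))]
    congr! 2 with s
    constructor
    · rintro ⟨h1, h2⟩
      rwa [hνc s h1] at h2
    · intro h
      exact ⟨hB s h, by rwa [hνc s (hB s h)]⟩
  let letter : ℕ → NetLetter G := fun s => match e s with
    | some (some j) => Sum.inr (v j (Nat.count (fun s => e s = some (some j)) s))
    | _ => Sum.inl (x (Nat.count (fun s => e s = some none) s))
  have hl1 : ∀ s, e s = some none →
      letter s = Sum.inl (x (Nat.count (fun s => e s = some none) s)) := by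
    intro s hs
    simp only [letter]
    rw [hs]
  have hl2 : ∀ s j, e s = some (some j) →
      letter s = Sum.inr (v j (Nat.count (fun s => e s = some (some j)) s)) := by
    intro s j hs
    simp only [letter]
    rw [hs]
  let u : ℕ → NetLetter G := fun i => letter (ν i)
  have hcases : ∀ s, A s → e s = some none ∨ ∃ j, e s = some (some j) := by
    intro s hs
    obtain ⟨_ | j, h⟩ := Option.isSome_iff_exists.1 hs
    · exact .inl h
    · exact .inr ⟨j, h⟩
  -- the contributor letters of `u`, continued arbitrarily if there are only finitely many of them
  let R : ℕ → Prop := fun i => ((u i).getRight?).isSome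
  have hR : ∀ i, R i ↔ ∃ j, e (ν i) = some (some j) := by
    intro i
    rcases hcases _ (hν i) with h | ⟨j, h⟩
    · simp [R, u, hl1 _ h, h]
    · simp [R, u, hl2 _ j h, h]
  let σ : ℕ → Fin k := fun c => ((e (ν (Nat.nth R c))).getD none).getD ⟨0, hk⟩
  have hσ : ∀ i j, e (ν i) = some (some j) → σ (Nat.count R i) = j := by
    intro i j h
    have hRi : R i := (hR i).2 ⟨j, h⟩
    simp only [σ]
    rw [Nat.nth_count hRi, h]
    rfl
  refine ⟨u, ⟨u, ⟨⟨x, hx, ?_⟩, u, ⟨fun i => rg (ν i), by simp [hν0, hrg0], ?_⟩, ?_⟩, ?_⟩,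
    fun t => v (σ t) (Nat.count (fun s => σ s = σ t) t), ⟨k, hk, v, hv, σ, fun t => rfl⟩, ?_⟩
  · rw [projIsPrefix_iff]
    intro i y hy
    rcases hcases _ (hν i) with h | ⟨j, h⟩
    · simp only [u, hl1 _ h, Sum.getLeft?_inl, Option.some.injEq] at hy
      rw [← hy, ← hcnt (fun s => e s = some none) (by intro s hs; simp [A, hs])]
      congr! 2
      funext i
      rcases hcases _ (hν i) with h | ⟨j, h⟩
      · simp [u, hl1 _ h, h]
      · simp [u, hl2 _ j h, h]
    · simp [u, hl2 _ j h] at hy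
  · intro i
    have h1 : rg (ν (i + 1)) = rg (ν i + 1) :=
      hgap i _ (hνmono (Nat.lt_succ_self i)) le_rfl
    simp only [h1]
    rcases hcases _ (hν i) with h | ⟨j, h⟩
    · simpa [u, hl1 _ h] using hlead _ h
    · simpa [u, hl2 _ j h] using hact _ j h
  · rw [projIsPrefix_iff]
    intro i y hy
    simpa [Nat.count_true] using hy
  · rw [projIsPrefix_iff]
    intro i y hy
    simpa [Nat.count_true] using hy
  · rw [projIsPrefix_iff]
    intro i y hy
    rcases hcases _ (hν i) with h | ⟨j, h⟩
    · simp [u, hl1 _ h] at hy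
    · simp only [u, hl2 _ j h, Sum.getRight?_inr, Option.some.injEq] at hy
      have h1 : Nat.count (fun i => (((u i).getRight?).isSome : Prop)) i = Nat.count R i := by
        congr!
      rw [← hy, h1, hσ i j h]
      congr 1
      rw [← hcnt (fun s => e s = some (some j)) (by intro s hs; simp [A, hs])]
      have h2 := count_count_comp R (fun c => σ c = j) i
      have h3 : Nat.count (fun s => σ s = j) (Nat.count R i) =
          Nat.count (fun s => R s ∧ σ (Nat.count R s) = j) i := by
        rw [← h2]
      rw [h3]
      congr! 2 with s
      constructor
      · rintro ⟨h4, h5⟩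
        obtain ⟨j', hj'⟩ := (hR s).1 h4
        rw [hj', ← h5, hσ s j' hj']
      · intro h4
        exact ⟨(hR s).2 ⟨j, h4⟩, hσ s j h4⟩

open Classical in
/-- Each instant of a synchronised run unfolds into a block of `k + 1` events: the principal actor
comes first, and the other contributors that act follow. -/
theorem NetRun.network_nonempty_fin {D L : Set (ℕ → RW G)} {k : ℕ} (hk : 1 ≤ k) {x : ℕ → RW G}
    (hx : x ∈ D) {v : Fin k → ℕ → RW G} (hv : ∀ j, v j ∈ L) (ρ : NetRun x v) :
    (network D L).Nonempty := by
  have hpr : ∀ t, ∃ p : Option (Fin k), (ρ.lead t → p = none) ∧ (¬ ρ.lead t → ∃ j, p = some j ∧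
      ρ.act j t ∧ ((v j (Nat.count (ρ.act j) t)).1 = RWKind.read → Held ρ.reg t)) := by
    intro t
    by_cases h : ρ.lead t
    · exact ⟨none, fun _ => rfl, fun h' => absurd h h'⟩
    · obtain ⟨j, hj⟩ := ρ.covered t h
      exact ⟨some j, fun h' => absurd h' h, fun _ => ⟨j, rfl, hj⟩⟩
  choose pr hpr1 hpr2 using hpr
  have hpr3 : ∀ t, pr t = none → ρ.lead t := by
    intro t ht
    by_contra h
    obtain ⟨j, hj, _⟩ := hpr2 t h
    rw [ht] at hj; cases hj
  have hpr4 : ∀ t j, pr t = some j →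
      ρ.act j t ∧ ((v j (Nat.count (ρ.act j) t)).1 = RWKind.read → Held ρ.reg t) := by
    intro t j ht
    by_cases h : ρ.lead t
    · rw [hpr1 t h] at ht; cases ht
    · obtain ⟨j', hj, h'⟩ := hpr2 t h
      rw [ht] at hj; cases hj; exact h'
  -- the event at place `r` of the block of instant `t`
  let ev : ℕ → ℕ → Option (Option (Fin k)) := fun t r =>
    if r = 0 then some (pr t) else
      if h : r - 1 < k then
        if ρ.act ⟨r - 1, h⟩ t ∧ pr t ≠ some ⟨r - 1, h⟩ then some (some ⟨r - 1, h⟩) else none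
      else none
  let e : ℕ → Option (Option (Fin k)) := fun s => ev (s / (k + 1)) (s % (k + 1))
  let rg : ℕ → Option G := fun s => Nat.casesOn s none fun s => some (ρ.reg (s / (k + 1)))
  have hdm : ∀ t r, r < k + 1 → (t * (k + 1) + r) / (k + 1) = t ∧
      (t * (k + 1) + r) % (k + 1) = r := by
    intro t r hr
    constructor
    · rw [Nat.mul_comm, Nat.mul_add_div (by omega), Nat.div_eq_of_lt hr, Nat.add_zero]
    · rw [Nat.mul_comm, Nat.mul_add_mod, Nat.mod_eq_of_lt hr]
  have he' : ∀ t r, r < k + 1 → e (t * (k + 1) + r) = ev t r := by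
    intro t r hr
    simp only [e, (hdm t r hr).1, (hdm t r hr).2]
  have hsplit : ∀ s, ∃ t r, r < k + 1 ∧ s = t * (k + 1) + r := by
    intro s
    refine ⟨s / (k + 1), s % (k + 1), Nat.mod_lt _ (by omega), ?_⟩
    rw [Nat.mul_comm]; exact (Nat.div_add_mod s (k + 1)).symm
  have hrg1 : ∀ t r, r < k + 1 → rg (t * (k + 1) + r + 1) = some (ρ.reg t) := by
    intro t r hr
    simp only [rg, (hdm t r hr).1]
  have hrg2 : ∀ t r, r < k + 1 → r ≠ 0 → rg (t * (k + 1) + r) = some (ρ.reg t) := by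
    intro t r hr hr0
    obtain _ | r := r
    · exact absurd rfl hr0
    · exact hrg1 t r (by omega)
  have hrg3 : ∀ t, Held ρ.reg t → rg (t * (k + 1)) = some (ρ.reg t) := by
    rintro t ⟨s, rfl, hs⟩
    rw [← hs, ← hrg1 s k (by omega), show s * (k + 1) + k + 1 = (s + 1) * (k + 1) by ring]
  have hmono : ∀ t t' r r', r < k + 1 → t < t' → t * (k + 1) + r < t' * (k + 1) + r' := by
    intro t t' r r' hr h
    have : (t + 1) * (k + 1) ≤ t' * (k + 1) := Nat.mul_le_mul_right _ h
    rw [Nat.succ_mul] at this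
    omega
  have hlead_iff : ∀ s, e s = some none ↔ ∃ t, ρ.lead t ∧ t * (k + 1) = s := by
    intro s
    obtain ⟨t, r, hr, rfl⟩ := hsplit s
    rw [he' t r hr]
    constructor
    · intro h
      by_cases hr0 : r = 0
      · simp only [ev, hr0, if_true, Option.some.injEq] at h
        exact ⟨t, hpr3 t h, by simp [hr0]⟩
      · simp only [ev, hr0, if_false] at h
        split_ifs at h; simp at h
    · rintro ⟨t', ht', h⟩
      have h1 := hdm t r hr
      rw [← h] at h1
      have h2 := hdm t' 0 (by omega)
      rw [Nat.add_zero] at h2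
      have e1 : t = t' := by rw [← h1.1, h2.1]
      have e2 : r = 0 := by rw [← h1.2, h2.2]
      simp [ev, e2, e1, hpr1 t' ht']
  let slot : Fin k → ℕ → ℕ := fun j t => if pr t = some j then 0 else j + 1
  have hslot : ∀ j t, slot j t < k + 1 := by
    intro j t
    simp only [slot]; grind
  have hact_iff : ∀ j s, e s = some (some j) ↔
      ∃ t, ρ.act j t ∧ t * (k + 1) + slot j t = s := by
    intro j s
    obtain ⟨t, r, hr, rfl⟩ := hsplit s
    rw [he' t r hr]
    constructor
    · intro h
      by_cases hr0 : r = 0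
      · simp only [ev, hr0, if_true, Option.some.injEq] at h
        exact ⟨t, (hpr4 t j h).1, by simp [slot, h, hr0]⟩
      · simp only [ev, hr0, if_false] at h
        split_ifs at h with h1 h2
        simp only [Option.some.injEq] at h
        subst h
        refine ⟨t, h2.1, ?_⟩
        simp only [slot, h2.2, if_false]
        omega
    · rintro ⟨t', ht', h⟩
      have h1 := hdm t r hr
      rw [← h] at h1
      have h2 := hdm t' _ (hslot j t')
      have e1 : t = t' := by rw [← h1.1, h2.1]
      have e2 : r = slot j t' := by rw [← h1.2, h2.2]
      subst e1
      by_cases hp : pr t = some j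
      · have : r = 0 := by rw [e2]; simp [slot, hp]
        simp [ev, this, hp]
      · have : r = j + 1 := by rw [e2]; simp [slot, hp]
        simp [ev, this, hp, ht']
  refine network_nonempty_of_events hk hx hv e ?_ ?_ rg rfl ?_ ?_ ?_
  · simp [e, ev]
  · rw [frequently_atTop]
    intro n
    refine ⟨n * (k + 1) + 0, by nlinarith, ?_⟩
    rw [he' _ _ (by omega)]
    simp [ev]
  · intro s hs
    obtain ⟨t, r, hr, rfl⟩ := hsplit s
    rw [he' t r hr] at hs
    have hr0 : r ≠ 0 := by rintro rfl; simp [ev] at hs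
    rw [hrg1 t r hr, hrg2 t r hr hr0]
  · intro s hs
    obtain ⟨t, ht, rfl⟩ := (hlead_iff s).1 hs
    have hc : Nat.count (fun s => e s = some none) (t * (k + 1)) = Nat.count ρ.lead t := by
      rw [← count_image (a := ρ.lead) (T := fun t => t * (k + 1)) ?_ ht]
      · congr! 2 with s; exact hlead_iff s
      · intro t t' _ _ h
        exact hmono t t' 0 0 (by omega) h
    rw [hc, show rg (t * (k + 1) + 1) = some (ρ.reg t) from hrg1 t 0 (by omega),
      ← ρ.lead_val t ht]
    refine .mk fun h => ?_
    rw [hrg3 t (ρ.lead_read t ht h), ρ.lead_val t ht]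
  · intro s j hs
    obtain ⟨t, ht, rfl⟩ := (hact_iff j s).1 hs
    have hc : Nat.count (fun s => e s = some (some j)) (t * (k + 1) + slot j t) =
        Nat.count (ρ.act j) t := by
      rw [← count_image (a := ρ.act j) (T := fun t => t * (k + 1) + slot j t) ?_ ht]
      · congr! 2 with s; exact hact_iff j s
      · intro t t' _ _ h
        exact hmono t t' _ _ (hslot j t) h
    rw [hc, hrg1 t _ (hslot j t), ← ρ.act_val j t ht]
    refine .mk fun h => ?_
    rw [ρ.act_val j t ht]
    by_cases hp : pr t = some j
    · rw [show slot j t = 0 by simp [slot, hp]]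
      exact hrg3 t ((hpr4 t j hp).2 h)
    · exact hrg2 t _ (hslot j t) (by simp [slot, hp])

theorem NetRun.network_nonempty {D L : Set (ℕ → RW G)} {J : Type*} [Finite J] [Nonempty J]
    {x : ℕ → RW G} (hx : x ∈ D) {v : J → ℕ → RW G} (hv : ∀ j, v j ∈ L) (ρ : NetRun x v) :
    (network D L).Nonempty := by
  obtain ⟨k, ⟨e⟩⟩ := Finite.exists_equiv_fin J
  have hk : 1 ≤ k := by
    by_contra h
    have : k = 0 := by omega
    subst this
    exact (e (Classical.arbitrary J)).elim0
  exact NetRun.network_nonempty_fin hk hx (v := fun i => v (e.symm i)) (fun i => hv _)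
    { reg := ρ.reg
      lead := ρ.lead
      act := fun i => ρ.act (e.symm i)
      lead_val := ρ.lead_val
      lead_read := ρ.lead_read
      act_val := fun i => ρ.act_val _
      covered := fun t ht => by
        obtain ⟨j, hj⟩ := ρ.covered t ht
        refine ⟨e j, ?_⟩
        rwa [e.symm_apply_apply] }

end NetRun

/-! ### Times after which the stack never gets lower -/

/-- The stack never gets lower than at time `s` after `s`. -/
def IsStackMin {Q Γ : Type*} (c : ℕ → Q × List Γ) (s : ℕ) : Prop :=
  ∀ t, s ≤ t → (c s).2.length ≤ (c t).2.length

theorem frequently_isStackMin {Q Γ : Type*} (c : ℕ → Q × List Γ) :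
    ∃ᶠ s in atTop, IsStackMin c s := by
  rw [frequently_atTop]
  intro B
  have hne : ∃ n, ∃ s ≥ B, (c s).2.length = n := ⟨_, B, le_rfl, rfl⟩
  classical
  obtain ⟨s, hs, hs'⟩ := Nat.find_spec hne
  refine ⟨s, hs, fun t ht => ?_⟩
  rw [hs']
  exact Nat.find_min' hne ⟨t, hs.trans ht, rfl⟩

/-! ### Runs of pushdown machines that forget the bottom of the stack -/

section PDM

variable {Q Γ A : Type*} [Finite Q] [Finite Γ] {P : PDM Q Γ A}

/-- A transition of `P` after which some symbols at the bottom of the stack may be discarded, but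
not the topmost symbol. -/
def PDM.DropStep (P : PDM Q Γ A) (c : Q × List Γ) (a : A) (c' : Q × List Γ) : Prop :=
  c'.2 ≠ [] ∧ ∃ w, P.Step c a (c'.1, w) ∧ c'.2 <+: w

/-- A `DropStep` that ends in a stack of height at most `N`. -/
def PDM.BddStep (P : PDM Q Γ A) (N : ℕ) (c : Q × List Γ) (a : A) (c' : Q × List Γ) : Prop :=
  P.DropStep c a c' ∧ c'.2.length ≤ N

theorem PDM.Step.ne_nil {c c' : Q × List Γ} {a : A} (h : P.Step c a c') : c.2 ≠ [] := by
  cases h <;> simp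

theorem PDM.Step.of_prefix {q q' : Q} {w u W : List Γ} {a : A} (h : P.Step (q, w) a (q', u))
    (hW : w <+: W) : ∃ U, P.Step (q, W) a (q', U) ∧ u <+: U := by
  obtain ⟨z, rfl⟩ := hW
  cases h with
  | pop _ h => exact ⟨_, .pop _ h, List.prefix_append _ _⟩
  | @push _ _ γ _ γ' w h => exact ⟨γ'.1 :: γ :: (w ++ z), .push _ h, by simp⟩

theorem PDM.Step.cancel_right {q q' : Q} {w z u : List Γ} {a : A} (hw : w ≠ [])
    (h : P.Step (q, w ++ z) a (q', u)) : ∃ u', u = u' ++ z ∧ P.Step (q, w) a (q', u') := by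
  obtain _ | ⟨γ, w⟩ := w
  · exact absurd rfl hw
  · rw [List.cons_append] at h
    cases h with
    | pop _ h => exact ⟨w, rfl, .pop _ h⟩
    | @push _ _ _ _ γ' _ h => exact ⟨γ'.1 :: γ :: w, rfl, .push _ h⟩

/-- A run that discards symbols never misses them, so the machine can make the same steps without
discarding anything. -/
theorem PDM.exists_run_of_dropStep {r : ℕ → Q × List Γ} {v : ℕ → A}
    (h0 : r 0 = (P.init, [P.bot])) (hr : ∀ i, P.DropStep (r i) (v i) (r (i + 1))) :
    ∃ c, P.IsRun v c ∧ ∀ i, (c i).1 = (r i).1 := by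
  obtain ⟨c, hc0, hc⟩ := exists_run_of_simulation (S := P.DropStep) (S' := P.Step)
    (R := fun c d => c.1 = d.1 ∧ c.2 <+: d.2) (by
      rintro ⟨q, w⟩ a ⟨q', u⟩ ⟨q₁, W⟩ ⟨_, w', h1, h2⟩ ⟨rfl, h4⟩
      obtain ⟨U, h5, h6⟩ := h1.of_prefix h4
      exact ⟨(q', U), h5, rfl, h2.trans h6⟩) hr (d := (P.init, [P.bot])) (by simp [h0])
  exact ⟨c, ⟨hc0, fun i => (hc i).1⟩, fun i => (hc i).2.1.symm⟩

theorem PDM.restriction_run_dropStep {N : ℕ} {hN : 1 ≤ N} {v : ℕ → A}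
    (h : v ∈ (P.restriction N hN).language) : ∃ r : ℕ → Q × List Γ,
      r 0 = (P.init, [P.bot]) ∧ ∀ i, P.BddStep N (r i) (v i) (r (i + 1)) := by
  obtain ⟨q, hq0, hq⟩ := h
  refine ⟨fun i => ((q i).1, (q i).2.1), by simp [hq0, PDM.restriction], fun i => ?_⟩
  obtain ⟨w, h1, h2⟩ := hq i
  refine ⟨⟨?_, w, h1, ?_⟩, (q (i + 1)).2.2.2⟩
  · intro h
    have := (q (i + 1)).2.2.1
    simp only at h
    rw [h] at this
    simp at this
  · simp only at h2 ⊢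
    rw [h2]
    exact List.take_prefix _ _

theorem PDM.restriction_language_subset {N : ℕ} {hN : 1 ≤ N} :
    (P.restriction N hN).language ⊆ P.language := by
  intro v hv
  obtain ⟨r, h0, hr⟩ := PDM.restriction_run_dropStep hv
  obtain ⟨c, hc, _⟩ := PDM.exists_run_of_dropStep h0 fun i => (hr i).1
  exact ⟨c, hc⟩

/-- The restriction discards only what it must, so it can follow any run with stacks of height at
most `N` that discards more. -/
theorem PDM.mem_restriction_language {N : ℕ} {hN : 1 ≤ N} {r : ℕ → Q × List Γ} {v : ℕ → A}
    (h0 : r 0 = (P.init, [P.bot])) (hr : ∀ i, P.BddStep N (r i) (v i) (r (i + 1))) :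
    v ∈ (P.restriction N hN).language := by
  obtain ⟨q, hq0, hq⟩ := exists_run_of_simulation (S := P.BddStep N)
    (S' := fun s a s' => (s, a, s') ∈ (P.restriction N hN).trans)
    (R := fun c d => c.1 = d.1 ∧ c.2 <+: d.2.1) (by
      rintro ⟨q, w⟩ a ⟨q', u⟩ ⟨q₁, W⟩ ⟨⟨h0, w', h1, h2⟩, h3⟩ ⟨rfl, h4⟩
      obtain ⟨U, h5, h6⟩ := h1.of_prefix h4
      simp only at h0 h2 h3
      have hu : u <+: U.take N := by
        have := (h2.trans h6).take N
        rwa [List.take_of_length_le h3] at this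
      refine ⟨(q', ⟨U.take N, ?_, List.length_take_le _ _⟩), ⟨U, h5, rfl⟩, rfl, hu⟩
      exact (List.length_pos_iff.2 h0).trans_le hu.length_le) hr
    (d := (P.restriction N hN).init) (by simp [h0, PDM.restriction])
  exact ⟨q, hq0, fun i => (hq i).1⟩

/-! ### Stack minima of runs -/


theorem PDM.IsRun.ne_nil {v : ℕ → A} {c : ℕ → Q × List Γ} (hc : P.IsRun v c) (i : ℕ) :
    (c i).2 ≠ [] := (hc.2 i).ne_nil

theorem PDM.IsRun.isStackMin_zero {v : ℕ → A} {c : ℕ → Q × List Γ} (hc : P.IsRun v c) :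
    IsStackMin c 0 := by
  intro t _
  rw [hc.1]
  exact List.length_pos_iff.2 (hc.ne_nil t)

/-- After a minimum, the symbols below the topmost one stay where they are. -/
theorem PDM.IsRun.exists_eq_append {v : ℕ → A} {c : ℕ → Q × List Γ} (hc : P.IsRun v c) {s : ℕ}
    (hs : IsStackMin c s) {γ : Γ} {z : List Γ} (hz : (c s).2 = γ :: z) {t : ℕ} (ht : s ≤ t) :
    ∃ y, y ≠ [] ∧ (c t).2 = y ++ z := by
  induction t, ht using Nat.le_induction with
  | base => exact ⟨[γ], by simp, by simp [hz]⟩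
  | succ t ht ih =>
    obtain ⟨y, hy, h⟩ := ih
    have h1 := hc.2 t
    rw [← Prod.mk.eta (p := c t), ← Prod.mk.eta (p := c (t + 1)), h] at h1
    obtain ⟨y', h2, _⟩ := h1.cancel_right hy
    refine ⟨y', ?_, h2⟩
    rintro rfl
    have := hs (t + 1) (by omega)
    simp [h2, hz] at this

/-- Between two times with the same state and the same topmost symbol, a run can be repeated forever
if the stack never gets lower after the first one. -/
theorem BuchiPDM.loop_mem_language {P : BuchiPDM Q Γ A} {v : ℕ → A} {c : ℕ → Q × List Γ}
    (hc : P.toPDM.IsRun v c) {a b d : ℕ} (ha : IsStackMin c a)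
    (hq : (c a).1 = (c b).1) (htop : (c a).2.head? = (c b).2.head?) (had : a ≤ d) (hdb : d < b)
    (hd : (c d).1 ∈ P.accepting) : (fun n => v (loopIdx a b n)) ∈ P.language := by
  obtain ⟨γ, z, hz⟩ := List.exists_cons_of_ne_nil (hc.ne_nil a)
  choose! y hy0 hy using fun t (ht : a ≤ t) => hc.exists_eq_append ha hz ht
  have hya : y a = [γ] := by
    have := hy a le_rfl
    rw [hz] at this
    exact (List.append_cancel_right (as := [γ]) (by simpa using this)).symm
  -- the run up to time `b`, where what lies below the topmost symbol is discarded at times `a`, `b`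
  let s : ℕ → Q × List Γ := fun i =>
    if i < a then c i else if i < b then ((c i).1, y i) else ((c a).1, [γ])
  have hab : a < b := by omega
  have hs1 : ∀ i, (s i).1 = (c i).1 ∨ b < i := by
    intro i
    rcases lt_trichotomy i b with h | rfl | h
    · left; simp only [s]; split_ifs <;> rfl
    · left; simp [s, hq, hab.not_gt]
    · exact .inr h
  have hstep : ∀ i < b, P.toPDM.DropStep (s i) (v i) (s (i + 1)) := by
    intro i hi
    have h1 := hc.2 i
    rw [← Prod.mk.eta (p := c i), ← Prod.mk.eta (p := c (i + 1))] at h1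
    by_cases hia : i < a
    · by_cases hia' : i + 1 < a
      · simp only [s, hia, hia', if_true]
        exact ⟨hc.ne_nil _, _, h1, List.prefix_rfl⟩
      · have : a = i + 1 := by omega
        subst this
        simp only [s, hi, hab, if_true, lt_irrefl, if_false, Nat.lt_succ_self]
        exact ⟨hy0 _ le_rfl, _, h1, by simp [hy _ le_rfl]⟩
    · rw [hy i (by omega)] at h1
      obtain ⟨u, h2, h3⟩ := h1.cancel_right (hy0 i (by omega))
      rw [hy (i + 1) (by omega)] at h2
      have h4 := List.append_cancel_right h2
      subst h4
      by_cases hib : i + 1 < b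
      · simp only [s, hia, hi, hib, if_true, if_false, show ¬ i + 1 < a by omega]
        exact ⟨hy0 _ (by omega), _, h3, List.prefix_rfl⟩
      · have : b = i + 1 := by omega
        subst this
        simp only [s, hia, hi, if_true, if_false, show ¬ i + 1 < a by omega, lt_irrefl, hq]
        refine ⟨by simp, _, h3, ?_⟩
        obtain ⟨γ', u, hu⟩ := List.exists_cons_of_ne_nil (hy0 (i + 1) (by omega))
        rw [hy (i + 1) (by omega), hz, hu] at htop
        simp only [List.cons_append, List.head?_cons, Option.some.injEq] at htop
        simp [hu, htop]
  have hsb : s b = s a := by simp [s, hab, hya, hab.not_gt]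
  have hrun := loopIdx_run (S := P.toPDM.DropStep) hab hstep hsb
  obtain ⟨c', hc', hc'q⟩ := PDM.exists_run_of_dropStep (P := P.toPDM)
    (r := fun n => s (loopIdx a b n)) (v := fun n => v (loopIdx a b n)) (by
      simp only [loopIdx, s]
      split_ifs with h1 h2
      · exact hc.1
      · have : a = 0 := by omega
        subst this
        have h3 := hc.1
        rw [h3] at hz
        simp only [List.cons.injEq] at hz
        rw [hya, h3, hz.1]
      · omega) hrun
  refine ⟨c', hc', ?_⟩
  rw [frequently_atTop]
  intro n
  refine ⟨d + n * (b - a), ?_, ?_⟩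
  · nlinarith [show 1 ≤ b - a by omega]
  · rw [hc'q]
    rw [loopIdx_add_mul_period hab had, loopIdx_of_lt hdb]
    rcases hs1 d with h | h
    · rwa [h]
    · omega

end PDM

/-! ### Pop trees and their compression -/

section Trees

open scoped List

variable {Q Γ A : Type*} [Finite Q] [Finite Γ]

/-- `PopTree P v S p γ q l`: reading the letters of `v` at the positions in the list `l`, the
machine `P` can go from state `p` with topmost symbol `γ` to state `q` with this symbol popped, and
never looks below it. The constructors spell out the tree of nested pushes and pops. No
node `(p, γ, q)` of the tree is in the set `S`. -/
inductive PopTree (P : PDM Q Γ A) (v : ℕ → A) (S : Set (Q × Γ × Q)) :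
    Q → Γ → Q → List ℕ → Prop
  | pop {p : Q} {γ : Γ} {q : Q} (n : ℕ) (hS : (p, γ, q) ∉ S)
      (h : (p, v n, γ, q, none) ∈ P.rules) : PopTree P v S p γ q [n]
  | push {p : Q} {γ : Γ} {p' : Q} {γ' : {γ : Γ // γ ≠ P.bot}} {r q : Q} (n : ℕ) {l₁ l₂ : List ℕ}
      (hS : (p, γ, q) ∉ S) (h : (p, v n, γ, p', some γ') ∈ P.rules)
      (h₁ : PopTree P v S p' γ'.1 r l₁) (h₂ : PopTree P v S r γ q l₂) :
      PopTree P v S p γ q (n :: (l₁ ++ l₂))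

/-- Pop trees with stack height at most `k` above the symbols that are not looked at. -/
inductive BddPopTree (P : PDM Q Γ A) (v : ℕ → A) : ℕ → Q → Γ → Q → List ℕ → Prop
  | pop {p : Q} {γ : Γ} {q : Q} (k n : ℕ)
      (h : (p, v n, γ, q, none) ∈ P.rules) : BddPopTree P v (k + 1) p γ q [n]
  | push {p : Q} {γ : Γ} {p' : Q} {γ' : {γ : Γ // γ ≠ P.bot}} {r q : Q} (k n : ℕ)
      {l₁ l₂ : List ℕ} (h : (p, v n, γ, p', some γ') ∈ P.rules)
      (h₁ : BddPopTree P v k p' γ'.1 r l₁) (h₂ : BddPopTree P v (k + 1) r γ q l₂) :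
      BddPopTree P v (k + 1) p γ q (n :: (l₁ ++ l₂))

/-- Pop trees with a marked position `t` such that no node on the path from the root to the mark
is in `S`. -/
inductive MarkedPopTree (P : PDM Q Γ A) (v : ℕ → A) (t : ℕ) (S : Set (Q × Γ × Q)) :
    Q → Γ → Q → List ℕ → Prop
  | pop {p : Q} {γ : Γ} {q : Q} (hS : (p, γ, q) ∉ S)
      (h : (p, v t, γ, q, none) ∈ P.rules) : MarkedPopTree P v t S p γ q [t]
  | push {p : Q} {γ : Γ} {p' : Q} {γ' : {γ : Γ // γ ≠ P.bot}} {r q : Q} {l₁ l₂ : List ℕ}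
      (hS : (p, γ, q) ∉ S) (h : (p, v t, γ, p', some γ') ∈ P.rules)
      (h₁ : PopTree P v ∅ p' γ'.1 r l₁) (h₂ : PopTree P v ∅ r γ q l₂) :
      MarkedPopTree P v t S p γ q (t :: (l₁ ++ l₂))
  | left {p : Q} {γ : Γ} {p' : Q} {γ' : {γ : Γ // γ ≠ P.bot}} {r q : Q} (n : ℕ) {l₁ l₂ : List ℕ}
      (hS : (p, γ, q) ∉ S) (h : (p, v n, γ, p', some γ') ∈ P.rules)
      (h₁ : MarkedPopTree P v t S p' γ'.1 r l₁) (h₂ : PopTree P v ∅ r γ q l₂) :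
      MarkedPopTree P v t S p γ q (n :: (l₁ ++ l₂))
  | right {p : Q} {γ : Γ} {p' : Q} {γ' : {γ : Γ // γ ≠ P.bot}} {r q : Q} (n : ℕ) {l₁ l₂ : List ℕ}
      (hS : (p, γ, q) ∉ S) (h : (p, v n, γ, p', some γ') ∈ P.rules)
      (h₁ : PopTree P v ∅ p' γ'.1 r l₁) (h₂ : MarkedPopTree P v t S r γ q l₂) :
      MarkedPopTree P v t S p γ q (n :: (l₁ ++ l₂))

variable {P : PDM Q Γ A} {v : ℕ → A}

theorem BddPopTree.mono {k k' : ℕ} {p q : Q} {γ : Γ} {l : List ℕ} (h : BddPopTree P v k p γ q l)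
    (hk : k ≤ k') : BddPopTree P v k' p γ q l := by
  induction h generalizing k' with
  | pop k n h =>
    obtain ⟨k', rfl⟩ := Nat.exists_eq_succ_of_ne_zero (show k' ≠ 0 by omega)
    exact .pop _ _ h
  | push k n h _ _ ih₁ ih₂ =>
    obtain ⟨k', rfl⟩ := Nat.exists_eq_succ_of_ne_zero (show k' ≠ 0 by omega)
    exact .push _ _ h (ih₁ (by omega)) (ih₂ hk)

theorem BddPopTree.path {k : ℕ} {p q : Q} {γ : Γ} {l : List ℕ} (h : BddPopTree P v k p γ q l)
    {N : ℕ} {z : List Γ} (hz : z ≠ []) (hN : z.length + k ≤ N) :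
    LPath (P.BddStep N) (p, γ :: z) (l.map v) (q, z) := by
  induction h generalizing z with
  | pop k n h => exact .single ⟨⟨hz, z, .pop _ h, List.prefix_rfl⟩, by simp only; omega⟩
  | @push p γ p' γ' r q k n l₁ l₂ h h₁ _ ih₁ ih₂ =>
    rw [List.map_cons, List.map_append]
    refine .cons (c' := (p', γ'.1 :: γ :: z)) ⟨⟨by simp, _, .push _ h, List.prefix_rfl⟩, ?_⟩ ?_
    · cases h₁ <;> simp only [List.length_cons] <;> omega
    · exact (ih₁ (by simp) (by simp only [List.length_cons]; omega)).append (ih₂ hz hN)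

/-- If `x` is a node of a pop tree, then a deepest occurrence of `x` is the root of a pop tree in
which `x` does not occur again. -/
theorem PopTree.insert_or {S : Set (Q × Γ × Q)} (x : Q × Γ × Q) {p q : Q} {γ : Γ} {l : List ℕ}
    (h : PopTree P v S p γ q l) :
    PopTree P v (insert x S) p γ q l ∨
    (∃ n, [n] <+ l ∧ (x.1, v n, x.2.1, x.2.2, none) ∈ P.rules) ∨
    ∃ n l₁ l₂ p' γ' r, (n :: (l₁ ++ l₂)) <+ l ∧ (x.1, v n, x.2.1, p', some γ') ∈ P.rules ∧
      PopTree P v (insert x S) p' γ'.1 r l₁ ∧ PopTree P v (insert x S) r x.2.1 x.2.2 l₂ := by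
  induction h with
  | @pop p γ q n hS h =>
    by_cases hx : (p, γ, q) = x
    · subst hx
      exact .inr (.inl ⟨n, List.Sublist.refl _, h⟩)
    · exact .inl (.pop n (by simp [hx, hS]) h)
  | @push p γ p' γ' r q n l₁ l₂ hS h _ _ ih₁ ih₂ =>
    have hs₁ : l₁ <+ n :: (l₁ ++ l₂) := ((List.sublist_append_left _ _).trans
      (List.sublist_cons_self _ _))
    have hs₂ : l₂ <+ n :: (l₁ ++ l₂) := ((List.sublist_append_right _ _).trans
      (List.sublist_cons_self _ _))
    rcases ih₁ with ih₁ | ⟨m, hm, h'⟩ | ⟨m, a, b, p'', γ'', r', hm, h'⟩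
    · rcases ih₂ with ih₂ | ⟨m, hm, h'⟩ | ⟨m, a, b, p'', γ'', r', hm, h'⟩
      · by_cases hx : (p, γ, q) = x
        · subst hx
          exact .inr (.inr ⟨n, l₁, l₂, p', γ', r, List.Sublist.refl _, h, ih₁, ih₂⟩)
        · exact .inl (.push n (by simp [hx, hS]) h ih₁ ih₂)
      · exact .inr (.inl ⟨m, hm.trans hs₂, h'⟩)
      · exact .inr (.inr ⟨m, a, b, p'', γ'', r', hm.trans hs₂, h'⟩)
    · exact .inr (.inl ⟨m, hm.trans hs₁, h'⟩)
    · exact .inr (.inr ⟨m, a, b, p'', γ'', r', hm.trans hs₁, h'⟩)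

theorem PopTree.root_notMem {S : Set (Q × Γ × Q)} {p q : Q} {γ : Γ} {l : List ℕ}
    (h : PopTree P v S p γ q l) : (p, γ, q) ∉ S := by
  cases h <;> assumption

theorem ncard_compl_insert_add_one {α : Type*} [Finite α] {S : Set α} {x : α} (hx : x ∉ S) :
    (insert x S)ᶜ.ncard + 1 = Sᶜ.ncard := by
  have : (insert x S)ᶜ = Sᶜ \ {x} := by
    ext y; simp [not_or, and_comm]
  rw [this]
  exact Set.ncard_sdiff_singleton_add_one (by simpa using hx)

/-- Dropping letters, a pop tree can be changed such that no node is nested in an equal one, which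
bounds its height by the number of possible nodes. -/
theorem PopTree.exists_bdd : ∀ (k : ℕ) (S : Set (Q × Γ × Q)), Sᶜ.ncard = k →
    ∀ {p q : Q} {γ : Γ} {l : List ℕ}, PopTree P v S p γ q l →
      ∃ l', l' <+ l ∧ BddPopTree P v k p γ q l' := by
  intro k
  induction k with
  | zero =>
    intro S hS p q γ l h
    have := ncard_compl_insert_add_one h.root_notMem
    omega
  | succ k ih =>
    intro S hS p q γ l h
    have hc := ncard_compl_insert_add_one h.root_notMem
    rcases h.insert_or (p, γ, q) with h' | ⟨n, hn, h'⟩ | ⟨n, l₁, l₂, p', γ', r, hl, h', h₁, h₂⟩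
    · exact absurd (mem_insert _ _) h'.root_notMem
    · exact ⟨_, hn, .pop k n h'⟩
    · obtain ⟨l₁', hl₁, h₁'⟩ := ih _ (by omega) h₁
      obtain ⟨l₂', hl₂, h₂'⟩ := ih _ (by omega) h₂
      exact ⟨n :: (l₁' ++ l₂'), ((hl₁.append hl₂).cons_cons n).trans hl,
        .push k n h' h₁' (h₂'.mono (by omega))⟩

theorem PopTree.exists_bdd_card {p q : Q} {γ : Γ} {l : List ℕ} (h : PopTree P v ∅ p γ q l) :
    ∃ l', l' <+ l ∧ BddPopTree P v (Nat.card (Q × Γ × Q)) p γ q l' :=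
  PopTree.exists_bdd _ ∅ (by rw [compl_empty, Set.ncard_univ]) h

theorem PopTree.marked {p q : Q} {γ : Γ} {l : List ℕ} (h : PopTree P v ∅ p γ q l) {t : ℕ}
    (ht : t ∈ l) : MarkedPopTree P v t ∅ p γ q l := by
  induction h with
  | pop n hS h =>
    obtain rfl : t = n := by simpa using ht
    exact .pop hS h
  | push n hS h h₁ h₂ ih₁ ih₂ =>
    rcases List.mem_cons.1 ht with rfl | ht
    · exact .push hS h h₁ h₂
    · rcases List.mem_append.1 ht with ht | ht
      · exact .left n hS h (ih₁ ht) h₂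
      · exact .right n hS h h₁ (ih₂ ht)

theorem MarkedPopTree.root_notMem {S : Set (Q × Γ × Q)} {t : ℕ} {p q : Q} {γ : Γ} {l : List ℕ}
    (h : MarkedPopTree P v t S p γ q l) : (p, γ, q) ∉ S := by
  cases h <;> assumption

/-- The marked version of `PopTree.insert_or`: if `x` is on the path to the mark, then its last
occurrence there is the root of a marked pop tree whose path does not visit `x` again. -/
theorem MarkedPopTree.insert_or {S : Set (Q × Γ × Q)} {t : ℕ} (x : Q × Γ × Q) {p q : Q} {γ : Γ}
    {l : List ℕ} (h : MarkedPopTree P v t S p γ q l) :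
    MarkedPopTree P v t (insert x S) p γ q l ∨
    ([t] <+ l ∧ (x.1, v t, x.2.1, x.2.2, none) ∈ P.rules) ∨
    ∃ n l₁ l₂ p' γ' r, (n :: (l₁ ++ l₂)) <+ l ∧ (x.1, v n, x.2.1, p', some γ') ∈ P.rules ∧
      ((n = t ∧ PopTree P v ∅ p' γ'.1 r l₁ ∧ PopTree P v ∅ r x.2.1 x.2.2 l₂) ∨
        (MarkedPopTree P v t (insert x S) p' γ'.1 r l₁ ∧ PopTree P v ∅ r x.2.1 x.2.2 l₂) ∨
        (PopTree P v ∅ p' γ'.1 r l₁ ∧ MarkedPopTree P v t (insert x S) r x.2.1 x.2.2 l₂)) := by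
  have hs₁ : ∀ (n : ℕ) (l₁ l₂ : List ℕ), l₁ <+ n :: (l₁ ++ l₂) := fun n l₁ l₂ =>
    (List.sublist_append_left _ _).trans (List.sublist_cons_self _ _)
  have hs₂ : ∀ (n : ℕ) (l₁ l₂ : List ℕ), l₂ <+ n :: (l₁ ++ l₂) := fun n l₁ l₂ =>
    (List.sublist_append_right _ _).trans (List.sublist_cons_self _ _)
  induction h with
  | @pop p γ q hS h =>
    by_cases hx : (p, γ, q) = x
    · subst hx
      exact .inr (.inl ⟨List.Sublist.refl _, h⟩)
    · exact .inl (.pop (by simp [hx, hS]) h)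
  | @push p γ p' γ' r q l₁ l₂ hS h h₁ h₂ =>
    by_cases hx : (p, γ, q) = x
    · subst hx
      exact .inr (.inr ⟨t, l₁, l₂, p', γ', r, List.Sublist.refl _, h, .inl ⟨rfl, h₁, h₂⟩⟩)
    · exact .inl (.push (by simp [hx, hS]) h h₁ h₂)
  | @left p γ p' γ' r q n l₁ l₂ hS h _ h₂ ih =>
    rcases ih with ih | ⟨hm, h'⟩ | ⟨m, a, b, p'', γ'', r', hm, h'⟩
    · by_cases hx : (p, γ, q) = x
      · subst hx
        exact .inr (.inr ⟨n, l₁, l₂, p', γ', r, List.Sublist.refl _, h, .inr (.inl ⟨ih, h₂⟩)⟩)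
      · exact .inl (.left n (by simp [hx, hS]) h ih h₂)
    · exact .inr (.inl ⟨hm.trans (hs₁ _ _ _), h'⟩)
    · exact .inr (.inr ⟨m, a, b, p'', γ'', r', hm.trans (hs₁ _ _ _), h'⟩)
  | @right p γ p' γ' r q n l₁ l₂ hS h h₁ _ ih =>
    rcases ih with ih | ⟨hm, h'⟩ | ⟨m, a, b, p'', γ'', r', hm, h'⟩
    · by_cases hx : (p, γ, q) = x
      · subst hx
        exact .inr (.inr ⟨n, l₁, l₂, p', γ', r, List.Sublist.refl _, h, .inr (.inr ⟨h₁, ih⟩)⟩)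
      · exact .inl (.right n (by simp [hx, hS]) h h₁ ih)
    · exact .inr (.inl ⟨hm.trans (hs₂ _ _ _), h'⟩)
    · exact .inr (.inr ⟨m, a, b, p'', γ'', r', hm.trans (hs₂ _ _ _), h'⟩)

/-- Dropping letters but not the mark, a marked pop tree can be changed such that no node occurs
twice on the path to the mark. The trees that hang off this path are then made low by
`PopTree.exists_bdd`. -/
theorem MarkedPopTree.exists_bdd {t : ℕ} : ∀ (k : ℕ) (S : Set (Q × Γ × Q)), Sᶜ.ncard = k →
    ∀ {p q : Q} {γ : Γ} {l : List ℕ}, MarkedPopTree P v t S p γ q l →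
      ∃ l', l' <+ l ∧ t ∈ l' ∧ BddPopTree P v (k + Nat.card (Q × Γ × Q)) p γ q l' := by
  intro k
  induction k with
  | zero =>
    intro S hS p q γ l h
    have := ncard_compl_insert_add_one h.root_notMem
    omega
  | succ k ih =>
    intro S hS p q γ l h
    rw [Nat.add_right_comm]
    have hc := ncard_compl_insert_add_one h.root_notMem
    rcases h.insert_or (p, γ, q) with h' | ⟨hn, h'⟩ | ⟨n, l₁, l₂, p', γ', r, hl, h', h⟩
    · exact absurd (mem_insert _ _) h'.root_notMem
    · exact ⟨_, hn, by simp, .pop _ t h'⟩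
    · rcases h with ⟨rfl, h₁, h₂⟩ | ⟨h₁, h₂⟩ | ⟨h₁, h₂⟩
      · obtain ⟨l₁', hl₁, h₁'⟩ := h₁.exists_bdd_card
        obtain ⟨l₂', hl₂, h₂'⟩ := h₂.exists_bdd_card
        exact ⟨n :: (l₁' ++ l₂'), ((hl₁.append hl₂).cons_cons n).trans hl, by simp,
          .push _ n h' (h₁'.mono (by omega)) (h₂'.mono (by omega))⟩
      · obtain ⟨l₁', hl₁, ht, h₁'⟩ := ih _ (by omega) h₁
        obtain ⟨l₂', hl₂, h₂'⟩ := h₂.exists_bdd_card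
        exact ⟨n :: (l₁' ++ l₂'), ((hl₁.append hl₂).cons_cons n).trans hl, by simp [ht],
          .push _ n h' h₁' (h₂'.mono (by omega))⟩
      · obtain ⟨l₁', hl₁, h₁'⟩ := h₁.exists_bdd_card
        obtain ⟨l₂', hl₂, ht, h₂'⟩ := ih _ (by omega) h₂
        exact ⟨n :: (l₁' ++ l₂'), ((hl₁.append hl₂).cons_cons n).trans hl, by simp [ht],
          .push _ n h' (h₁'.mono (by omega)) (h₂'.mono (by omega))⟩

theorem PopTree.exists_bdd_marked {p q : Q} {γ : Γ} {l : List ℕ} (h : PopTree P v ∅ p γ q l)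
    {t : ℕ} (ht : t ∈ l) : ∃ l', l' <+ l ∧ t ∈ l' ∧
      BddPopTree P v (2 * Nat.card (Q × Γ × Q)) p γ q l' := by
  rw [two_mul]
  exact (h.marked ht).exists_bdd _ ∅ (by rw [compl_empty, Set.ncard_univ])

/-- The part of a run up to the first time that the topmost symbol is popped is a pop tree. -/
theorem PDM.IsRun.popTree {c : ℕ → Q × List Γ} (hc : P.IsRun v c) : ∀ (n a : ℕ) (γ : Γ)
    (z : List Γ), (c a).2 = γ :: z → (∀ t < n, z.length < (c (a + t)).2.length) →
    (c (a + n)).2.length ≤ z.length →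
    (c (a + n)).2 = z ∧ PopTree P v ∅ (c a).1 γ (c (a + n)).1 (List.range' a n) := by
  intro n
  induction n using Nat.strong_induction_on with
  | _ n ih =>
    intro a γ z hz hn hle
    obtain _ | n := n
    · simp [hz] at hle
    have h1 := hc.2 a
    rw [← Prod.mk.eta (p := c a), ← Prod.mk.eta (p := c (a + 1)), hz] at h1
    generalize hc1 : (c (a + 1)).1 = q' at h1
    generalize hc2 : (c (a + 1)).2 = w' at h1
    cases h1 with
    | pop _ h =>
      obtain _ | n := n
      · exact ⟨hc2, by rw [hc1]; exact .pop a (by simp) h⟩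
      · have := hn 1 (by omega)
        simp [hc2] at this
    | @push _ _ _ _ γ' _ h =>
      have hlt : ∃ m, (c (a + 1 + m)).2.length ≤ (γ :: z).length :=
        ⟨n, by rw [show a + 1 + n = a + (n + 1) by omega, List.length_cons]; omega⟩
      classical
      set m := Nat.find hlt with hm
      have hmn : m ≤ n := Nat.find_min' hlt
        (by rw [show a + 1 + n = a + (n + 1) by omega, List.length_cons]; omega)
      obtain ⟨e1, h2⟩ := ih m (by omega) (a + 1) γ'.1 (γ :: z) hc2
        (fun t ht => not_le.1 (Nat.find_min hlt ht)) (Nat.find_spec hlt)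
      obtain ⟨d, rfl⟩ := Nat.exists_eq_add_of_le hmn
      have e2 : a + (m + d + 1) = a + 1 + m + d := by omega
      obtain ⟨e3, h3⟩ := ih d (by omega) (a + 1 + m) γ z e1
        (fun t ht => by
          have := hn (1 + m + t) (by omega)
          rwa [show a + (1 + m + t) = a + 1 + m + t by omega] at this)
        (by rwa [e2] at hle)
      rw [e2]
      refine ⟨e3, ?_⟩
      rw [hc1] at h2
      have e4 : List.range' a (m + d + 1) =
          a :: (List.range' (a + 1) m ++ List.range' (a + 1 + m) d) := by
        rw [List.range'_succ]
        congr 1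
        simp
      rw [e4]
      exact .push a (by simp) h h2 h3

/-- From one stack minimum to the next one, the machine either pushes a symbol that stays, or pushes
a symbol and pops it again. In both cases some low run keeps the marked letter. -/
theorem PDM.IsRun.exists_path_to_next_min {c : ℕ → Q × List Γ} (hc : P.IsRun v c) {N : ℕ}
    (hN : 2 * Nat.card (Q × Γ × Q) + 1 ≤ N) {s s' : ℕ} (hs : IsStackMin c s)
    (hs' : IsStackMin c s') (hlt : s < s') :
    ∃ s₁, s < s₁ ∧ s₁ ≤ s' ∧ IsStackMin c s₁ ∧ ∀ t, s ≤ t → t < s₁ →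
      ∃ l, l <+ List.range' s (s₁ - s) ∧ t ∈ l ∧
        LPath (P.BddStep N) ((c s).1, (c s).2.take 1) (l.map v) ((c s₁).1, (c s₁).2.take 1) := by
  obtain ⟨γ, z, hz⟩ := List.exists_cons_of_ne_nil (hc.ne_nil s)
  have hcard : 0 < Nat.card (Q × Γ × Q) := by
    have : Nonempty (Q × Γ × Q) := ⟨((c s).1, γ, (c s).1)⟩
    exact Nat.card_pos
  have h1 := hc.2 s
  rw [← Prod.mk.eta (p := c s), ← Prod.mk.eta (p := c (s + 1)), hz] at h1
  rw [hz]
  generalize hc1 : (c (s + 1)).1 = q' at h1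
  generalize hc2 : (c (s + 1)).2 = w' at h1
  cases h1 with
  | pop _ h =>
    have := hs (s + 1) (by omega)
    simp [hz, hc2] at this
  | @push _ _ _ _ γ' _ h =>
    by_cases hmin : IsStackMin c (s + 1)
    · refine ⟨s + 1, by omega, hlt, hmin, fun t ht ht' => ?_⟩
      obtain rfl : t = s := by omega
      refine ⟨[t], by simp, by simp, .single ?_⟩
      rw [hc1, hc2]
      exact ⟨⟨by simp, _, .push [] h, by simp⟩, by simp; omega⟩
    · have hret : ∃ m, (c (s + 1 + m)).2.length ≤ (γ :: z).length := by
        unfold IsStackMin at hmin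
        push Not at hmin
        obtain ⟨t, ht, h2⟩ := hmin
        refine ⟨t - (s + 1), ?_⟩
        rw [Nat.add_sub_cancel' ht]
        rw [hc2] at h2
        simp only [List.length_cons] at h2 ⊢
        omega
      classical
      set m := Nat.find hret with hm
      obtain ⟨e1, h2⟩ := hc.popTree m (s + 1) γ'.1 (γ :: z) hc2
        (fun t ht => not_le.1 (Nat.find_min hret ht)) (Nat.find_spec hret)
      rw [hc1] at h2
      refine ⟨s + 1 + m, by omega, ?_, ?_, ?_⟩
      · by_contra hcon
        have h3 := Nat.find_min hret (m := s' - (s + 1)) (by omega)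
        rw [Nat.add_sub_cancel' hlt] at h3
        have h4 := hs' (s + 1 + m) (by omega)
        rw [e1] at h4
        omega
      · intro t ht
        rw [e1, ← hz]
        exact hs t (by omega)
      · intro t hst htm
        have hm0 : 0 < m := by
          by_contra h0
          have := Nat.find_spec hret
          rw [← hm, show m = 0 by omega, Nat.add_zero, hc2] at this
          simp at this
        obtain ⟨l, hl, htl, h3⟩ : ∃ l, l <+ List.range' (s + 1) m ∧ (t = s ∨ t ∈ l) ∧
            BddPopTree P v (2 * Nat.card (Q × Γ × Q)) q' γ'.1 (c (s + 1 + m)).1 l := by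
          rcases hst.lt_or_eq with h | h
          · obtain ⟨l, hl, ht, h3⟩ := h2.exists_bdd_marked (t := t)
              (by rw [List.mem_range'_1]; omega)
            exact ⟨l, hl, .inr ht, h3⟩
          · obtain ⟨l, hl, _, h3⟩ := h2.exists_bdd_marked (t := s + 1)
              (by rw [List.mem_range'_1]; omega)
            exact ⟨l, hl, .inl h.symm, h3⟩
        refine ⟨s :: l, ?_, by simpa using htl, ?_⟩
        · rw [show s + 1 + m - s = m + 1 by omega, List.range'_succ]
          exact hl.cons_cons s
        · rw [e1]
          refine .cons (c' := (q', [γ'.1, γ])) ⟨⟨by simp, _, .push [] h, by simp⟩, ?_⟩ ?_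
          · simp only [List.length_cons, List.length_nil]; omega
          · exact h3.path (by simp) (by simp only [List.length_cons, List.length_nil]; omega)

theorem PDM.IsRun.exists_path_to_min {c : ℕ → Q × List Γ} (hc : P.IsRun v c) {N : ℕ}
    (hN : 2 * Nat.card (Q × Γ × Q) + 1 ≤ N) {s' : ℕ} (hs' : IsStackMin c s') :
    ∀ (d s : ℕ), s' - s = d → IsStackMin c s → ∀ t, s ≤ t → t < s' →
      ∃ l, l <+ List.range' s (s' - s) ∧ t ∈ l ∧
        LPath (P.BddStep N) ((c s).1, (c s).2.take 1) (l.map v) ((c s').1, (c s').2.take 1) := by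
  intro d
  induction d using Nat.strong_induction_on with
  | _ d ih =>
    intro s hd hs t hst hts
    obtain ⟨s₁, h1, h2, h3, h4⟩ := hc.exists_path_to_next_min hN hs hs' (by omega)
    rcases h2.lt_or_eq with h2 | rfl
    · have hr : List.range' s (s' - s) =
          List.range' s (s₁ - s) ++ List.range' s₁ (s' - s₁) := by
        have := List.range'_append (s := s) (m := s₁ - s) (n := s' - s₁) (step := 1)
        rw [show s + 1 * (s₁ - s) = s₁ by omega, show s₁ - s + (s' - s₁) = s' - s by omega] at this
        exact this.symm
      obtain ⟨l₁, hl₁, ht₁, hp₁⟩ := h4 (if t < s₁ then t else s) (by split_ifs <;> omega)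
        (by split_ifs <;> omega)
      obtain ⟨l₂, hl₂, ht₂, hp₂⟩ := ih _ (by omega) s₁ rfl h3 (if t < s₁ then s₁ else t)
        (by split_ifs <;> omega) (by split_ifs <;> omega)
      refine ⟨l₁ ++ l₂, by rw [hr]; exact hl₁.append hl₂, ?_, ?_⟩
      · split_ifs at ht₁ ht₂ <;> simp [ht₁, ht₂]
      · rw [List.map_append]
        exact hp₁.append hp₂
    · exact h4 t hst hts

/-- Every letter of a word of `P` also occurs in an ultimately periodic word with a low run, whose
preperiod and first period form a subword of the original word. The preperiod can be taken
before, and the period after, a position `s₀` that does not depend on the letter. -/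
theorem PDM.exists_periodic_subword (hv : v ∈ P.language) {N : ℕ} (hN1 : 1 ≤ N)
    (hN : 2 * Nat.card (Q × Γ × Q) + 1 ≤ N) (B : ℕ) :
    ∃ s₀ ≥ B, ∀ n, ∃ (a b m : ℕ) (f : ℕ → ℕ), a < b ∧ m < b ∧ f m = n ∧
      (∀ i j, i < j → j < b → f i < f j) ∧ (∀ j, a ≤ j → j < b → s₀ ≤ f j) ∧ (s₀ ≤ n → a ≤ m) ∧
      (fun j => v (f (loopIdx a b j))) ∈ (P.restriction N hN1).language := by
  obtain ⟨c, hc⟩ := hv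
  -- infinitely many minima share their state and topmost symbol
  have hfin : Finite {w : List Γ // w.length ≤ 1} := (List.finite_length_le Γ 1).to_subtype
  obtain ⟨k, hk⟩ := exists_frequently_eq (frequently_isStackMin c)
    (fun s => ((c s).1, (⟨(c s).2.take 1, List.length_take_le _ _⟩ : {w : List Γ // w.length ≤ 1})))
    (K := Q × {w : List Γ // w.length ≤ 1})
  obtain ⟨s₀, hs₀B, hs₀, hks₀⟩ := frequently_atTop.1 hk (B + 1)
  refine ⟨s₀, by omega, fun n => ?_⟩
  obtain ⟨s', hs'n, hs', hks'⟩ := frequently_atTop.1 hk (max (n + 1) (s₀ + 1))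
  have htop : ((c s').1, (c s').2.take 1) = ((c s₀).1, (c s₀).2.take 1) := by
    have := hks'.trans hks₀.symm
    simp only [Prod.mk.injEq, Subtype.mk.injEq] at this
    rw [this.1, this.2]
  have h0 := hc.isStackMin_zero
  obtain ⟨l₁, hl₁, ht₁, hp₁⟩ := hc.exists_path_to_min hN hs₀ _ 0 rfl h0
    (if n < s₀ then n else 0) (by omega) (by split_ifs <;> omega)
  obtain ⟨l₂, hl₂, ht₂, hp₂⟩ := hc.exists_path_to_min hN hs' _ s₀ rfl hs₀
    (if n < s₀ then s₀ else n) (by split_ifs <;> omega) (by split_ifs <;> omega)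
  rw [htop] at hp₂
  obtain ⟨r₁, hr₁0, hr₁l, hr₁⟩ := hp₁.exists_states
  obtain ⟨r₂, hr₂0, hr₂l, hr₂⟩ := hp₂.exists_states
  simp only [List.length_map, List.getElem_map] at hr₁l hr₁ hr₂l hr₂
  have hpos₂ : 0 < l₂.length := List.length_pos_of_mem ht₂
  let f : ℕ → ℕ := fun i => (l₁ ++ l₂).getD i 0
  have hf : ∀ i (hi : i < (l₁ ++ l₂).length), f i = (l₁ ++ l₂)[i] := by
    intro i hi
    exact List.getD_eq_getElem _ _ hi
  have hsub : (l₁ ++ l₂) <+ List.range' 0 s' := by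
    have h := hl₁.append hl₂
    have h' := List.range'_append (s := 0) (m := s₀ - 0) (n := s' - s₀) (step := 1)
    rw [show 0 + 1 * (s₀ - 0) = s₀ by omega, show s₀ - 0 + (s' - s₀) = s' by omega] at h'
    rwa [h'] at h
  have hsorted : (l₁ ++ l₂).Pairwise (· < ·) := (List.pairwise_lt_range' (s := 0)).sublist hsub
  have hlen : (l₁ ++ l₂).length = l₁.length + l₂.length := List.length_append
  have hf₁ : ∀ i (hi : i < l₁.length), f i = l₁[i] := by
    intro i hi
    rw [hf i (by omega), List.getElem_append_left hi]
  have hf₂ : ∀ i (hi : i < l₂.length), f (l₁.length + i) = l₂[i] := by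
    intro i hi
    rw [hf _ (by omega), List.getElem_append_right (by omega)]
    simp
  obtain ⟨m, hm, hmn, hms⟩ : ∃ m < l₁.length + l₂.length, f m = n ∧ (s₀ ≤ n → l₁.length ≤ m) := by
    by_cases hn : n < s₀
    · simp only [hn, if_true] at ht₁
      obtain ⟨i, hi, h⟩ := List.getElem_of_mem ht₁
      exact ⟨i, by omega, by rw [hf₁ i hi, h], by omega⟩
    · simp only [hn, if_false] at ht₂
      obtain ⟨i, hi, h⟩ := List.getElem_of_mem ht₂
      exact ⟨l₁.length + i, by omega, by rw [hf₂ i hi, h], by omega⟩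
  refine ⟨l₁.length, l₁.length + l₂.length, m, f, by omega, hm, hmn, ?_, ?_, hms, ?_⟩
  · intro i j hij hj
    rw [hf i (by omega), hf j (by omega)]
    exact List.pairwise_iff_getElem.1 hsorted _ _ (by omega) (by omega) hij
  · intro j hj hj'
    obtain ⟨i, rfl⟩ := Nat.exists_eq_add_of_le hj
    rw [hf₂ i (by omega)]
    have := hl₂.subset (List.getElem_mem (l := l₂) (n := i) (by omega))
    rw [List.mem_range'_1] at this
    exact this.1
  · let r : ℕ → Q × List Γ := fun i => if i < l₁.length then r₁ i else r₂ (i - l₁.length)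
    have hrrun := loopIdx_run (S := P.BddStep N) (s := r) (v := fun i => v (f i))
      (a := l₁.length) (b := l₁.length + l₂.length) (by omega) (by
        intro i hi
        simp only [r]
        rcases lt_or_ge i l₁.length with h | h
        · simp only [h, if_true]
          rw [hf₁ i h]
          by_cases h' : i + 1 < l₁.length
          · simp only [h', if_true]
            exact hr₁ i h
          · simp only [h', if_false]
            have : i + 1 = l₁.length := by omega
            rw [this, Nat.sub_self, hr₂0, ← hr₁l, ← this]
            exact hr₁ i h
        · obtain ⟨j, rfl⟩ := Nat.exists_eq_add_of_le h
          simp only [show ¬ l₁.length + j < l₁.length by omega,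
            show ¬ l₁.length + j + 1 < l₁.length by omega, if_false]
          rw [hf₂ j (by omega), Nat.add_sub_cancel_left, Nat.add_assoc, Nat.add_sub_cancel_left]
          exact hr₂ j (by omega)) (by
        simp [r, hr₂0, hr₂l])
    refine PDM.mem_restriction_language (r := fun j => r (loopIdx _ _ j)) ?_ hrrun
    have hinit : ((c 0).1, (c 0).2.take 1) = (P.init, [P.bot]) := by rw [hc.1]; rfl
    have hpos₁ : 0 < l₁.length := List.length_pos_of_mem ht₁
    simp only [loopIdx, r, hpos₁, if_true]
    rw [hr₁0, hinit]

end Trees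

/-! ### Looping a network run -/

section Loop

variable {G : Type*}

theorem Held.comp_loopIdx {reg : ℕ → G} {a b : ℕ} (h : reg (a - 1) = reg (b - 1)) {t : ℕ}
    (ht : Held reg (loopIdx a b t)) : Held (fun t => reg (loopIdx a b t)) t := by
  obtain ⟨s, hs, hr⟩ := ht
  obtain _ | t := t
  · simp [loopIdx] at hs
  · refine ⟨t, rfl, ?_⟩
    simp only
    rw [← hr]
    simp only [loopIdx] at hs
    split_ifs at hs with hb
    · rw [show loopIdx a b t = b - 1 by omega, ← h, hs, Nat.add_sub_cancel]
    · rw [show loopIdx a b t = s by omega]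

/-- If a run is looped, then the numbers of the letters that one actor performs are looped too. -/
theorem loopIdx_count_comp {p : ℕ → Prop} [DecidablePred p] {a b : ℕ} (hab : a ≤ b) (t : ℕ) :
    loopIdx (Nat.count p a) (Nat.count p b) (Nat.count (fun t => p (loopIdx a b t)) t) =
      loopIdx (Nat.count p a) (Nat.count p b) (Nat.count p (loopIdx a b t)) := by
  have hC : Nat.count p a ≤ Nat.count p b := Nat.count_monotone p hab
  induction t with
  | zero => simp [loopIdx]
  | succ t ih =>
    have h1 : loopIdx (Nat.count p a) (Nat.count p b)
          (Nat.count (fun t => p (loopIdx a b t)) (t + 1)) =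
        loopIdx (Nat.count p a) (Nat.count p b) (Nat.count p (loopIdx a b t + 1)) := by
      rw [Nat.count_succ, Nat.count_succ]
      split_ifs
      · simp only [loopIdx, ih]
      · exact ih
    rw [h1]
    by_cases hb : loopIdx a b t + 1 = b
    · rw [show loopIdx a b (t + 1) = a by simp [loopIdx, hb], hb, loopIdx_end hC]
      rcases hC.lt_or_eq with h | h
      · rw [loopIdx_of_lt h]
      · rw [← h, loopIdx_self]
    · rw [show loopIdx a b (t + 1) = loopIdx a b t + 1 by simp [loopIdx, hb]]

open Classical in
/-- An actor that performs letter `j` at instant `T j`, for `j` in an initial segment `K`, has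
performed `j` letters before. -/
theorem count_schedule {K : ℕ → Prop} (hK : ∀ i j, i < j → K j → K i) {T : ℕ → ℕ}
    (hT : ∀ i j, K j → i < j → T i < T j) {j : ℕ} (hj : K j) :
    Nat.count (fun t => ∃ j, K j ∧ T j = t) (T j) = j := by
  rw [count_image (fun i j _ hj h => hT i j hj h) hj]
  exact Nat.count_of_forall fun i hi => hK i j hi hj

open Classical in
/-- Consider a contributor on `v`, acting at the instants in `α`, in a network run whose part
`[T₀, T₁)` is repeated forever. Finitely many contributors with words in `L` can perform its action
of instant `s`, each time instant `s` is repeated. The first time, each of them can follow the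
original contributor up to the action. Thereafter it still has to get through its period, of
length `e`, and it performs one letter per iteration, which is possible since every value of these
letters occurs in every iteration. So `e` of them, started one iteration apart, suffice. -/
theorem exists_helpers {L : Set (ℕ → RW G)} {v : ℕ → RW G} {s₀ : ℕ}
    (hper : ∀ n, ∃ (a b m : ℕ) (f : ℕ → ℕ), a < b ∧ m < b ∧ f m = n ∧
      (∀ i j, i < j → j < b → f i < f j) ∧ (∀ j, a ≤ j → j < b → s₀ ≤ f j) ∧ (s₀ ≤ n → a ≤ m) ∧
      (fun j => v (f (loopIdx a b j))) ∈ L)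
    {reg : ℕ → G} {α : ℕ → Prop} (hval : ∀ t, α t → (v (Nat.count α t)).2 = reg t)
    {T₀ T₁ s : ℕ} (hTT : T₀ < T₁) (hs : s < T₁)
    (hrec : T₀ ≤ s → α s → s₀ ≤ Nat.count α T₀ ∧
      ∀ j ≥ s₀, ∃ t, T₀ ≤ t ∧ t < T₁ ∧ reg t = (v j).2) :
    ∃ e, 0 < e ∧ ∃ (w : Fin e → ℕ → RW G) (act : Fin e → ℕ → Prop), (∀ r, w r ∈ L) ∧
      (∀ r t, act r t → (w r (Nat.count (act r) t)).2 = reg (loopIdx T₀ T₁ t)) ∧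
      (α s → ∀ t, loopIdx T₀ T₁ t = s →
        ∃ r, act r t ∧ w r (Nat.count (act r) t) = v (Nat.count α s)) := by
  obtain ⟨a, b, m, f, hab, hmb, hfm, hmono, hfs, hm, hw⟩ := hper (Nat.count α s)
  by_cases hα : α s
  swap
  · exact ⟨1, one_pos, fun _ => _, fun _ _ => False, fun _ => hw, by simp, by simp [hα]⟩
  -- the instants at which the original contributor performs the letters up to the action
  have hτ : ∀ j, ∃ t, j ≤ m → t < s + 1 ∧ α t ∧ Nat.count α t = f j := by
    intro j
    by_cases hj : j ≤ m
    · have h1 : f j < Nat.count α (s + 1) := by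
        rw [Nat.count_succ, if_pos hα, ← hfm]
        rcases hj.lt_or_eq with h | rfl
        · have := hmono j m h hmb
          omega
        · omega
      obtain ⟨t, ht⟩ := exists_of_lt_count h1
      exact ⟨t, fun _ => ht⟩
    · exact ⟨0, fun h => absurd h hj⟩
  choose τ hτ using hτ
  have hτm : τ m = s := Nat.count_injective (hτ m le_rfl).2.1 hα ((hτ m le_rfl).2.2.trans hfm)
  have hτmono : ∀ i j, j ≤ m → i < j → τ i < τ j := by
    intro i j hj hij
    apply lt_of_count_lt (a := α)
    rw [(hτ i (by omega)).2.2, (hτ j hj).2.2]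
    exact hmono i j hij (by omega)
  have hτval : ∀ j ≤ m, (v (f (loopIdx a b j))).2 = reg (loopIdx T₀ T₁ (τ j)) := by
    intro j hj
    obtain ⟨h1, h2, h3⟩ := hτ j hj
    rw [loopIdx_of_lt (by omega), loopIdx_of_lt (by omega), ← hval _ h2, h3]
  rcases lt_or_ge s T₀ with hsT | hsT
  · -- the action is not repeated
    have hcnt := fun j (hj : j ≤ m) => count_schedule (K := fun j => j ≤ m) (T := τ)
      (fun i j h h' => by omega) hτmono hj
    refine ⟨1, one_pos, fun _ => _, fun _ t => ∃ j, j ≤ m ∧ τ j = t, fun _ => hw, ?_, ?_⟩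
    · rintro _ _ ⟨j, hj, rfl⟩
      rw [hcnt j hj]
      exact hτval j hj
    · intro _ t ht
      have hts : t = s := by
        rcases lt_or_ge t T₁ with h | h
        · rwa [loopIdx_of_lt h] at ht
        · have := le_loopIdx (a := T₀) (b := T₁) (n := t) (by omega) (by omega)
          omega
      refine ⟨0, ⟨m, le_rfl, by omega⟩, ?_⟩
      simp only
      rw [hts, ← hτm, hcnt m le_rfl, hτm, loopIdx_of_lt hmb, hfm]
  · obtain ⟨hs₀, hinf⟩ := hrec hsT hα
    have ham : a ≤ m := hm (hs₀.trans (Nat.count_monotone α hsT))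
    obtain ⟨P, hP⟩ : ∃ P, P = T₁ - T₀ := ⟨_, rfl⟩
    obtain ⟨e, he⟩ : ∃ e, e = b - a := ⟨_, rfl⟩
    have hmper : ∀ i, loopIdx a b (m + i * e) = m := by
      intro i
      rw [he, loopIdx_add_mul_period hab ham, loopIdx_of_lt hmb]
    have ho : ∀ q, ∃ o < P, (v (f (loopIdx a b (m + q)))).2 = reg (loopIdx T₀ T₁ (s + o)) ∧
        (e ∣ q → o = 0) := by
      intro q
      by_cases hq : e ∣ q
      · obtain ⟨i, rfl⟩ := hq
        refine ⟨0, by omega, ?_, fun _ => rfl⟩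
        rw [Nat.mul_comm, hmper, Nat.add_zero, loopIdx_of_lt hs, hfm, hval s hα]
      · obtain ⟨t, ht₀, ht₁, ht⟩ := hinf (f (loopIdx a b (m + q)))
          (hfs _ (le_loopIdx hab.le (by omega)) (loopIdx_lt hab _))
        obtain ⟨o, ho, hot⟩ := exists_loopIdx_add_eq ht₀ ht₁ hsT
        exact ⟨o, by omega, by rw [hot, ht], fun h => absurd h hq⟩
    choose o hoP hoval ho0 using ho
    -- contributor `r` performs letter `m + q` in iteration `r + q` after the instant `s`
    let T : ℕ → ℕ → ℕ := fun r j => if j < m then τ j else s + (j - m + r) * P + o (j - m)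
    have hTm : ∀ r q, T r (m + q) = s + (q + r) * P + o q := by
      intro r q
      simp only [T, show ¬ m + q < m by omega, if_false, Nat.add_sub_cancel_left]
    have hTmono : ∀ r i j, True → i < j → T r i < T r j := by
      intro r i j _ hij
      rcases lt_or_ge j m with hj | hj
      · simp only [T, hj, hij.trans hj, if_true]
        exact hτmono i j hj.le hij
      · obtain ⟨q, rfl⟩ := Nat.exists_eq_add_of_le hj
        rw [hTm]
        rcases lt_or_ge i m with hi | hi
        · simp only [T, hi, if_true]
          have := hτmono i m le_rfl hi
          omega
        · obtain ⟨q', rfl⟩ := Nat.exists_eq_add_of_le hi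
          rw [hTm]
          have h1 := hoP q'
          have h2 : (q' + r + 1) * P ≤ (q + r) * P := Nat.mul_le_mul_right _ (by omega)
          rw [Nat.succ_mul] at h2
          omega
    have hcnt := fun r j => count_schedule (K := fun _ => True) (T := T r)
      (fun i j h h' => trivial) (hTmono r) (j := j) trivial
    refine ⟨e, by omega, fun _ => _, fun r t => ∃ j, True ∧ T r j = t, fun _ => hw, ?_, ?_⟩
    · rintro r _ ⟨j, _, rfl⟩
      rw [hcnt r j]
      rcases lt_or_ge j m with hj | hj
      · simp only [T, hj, if_true]
        exact hτval j hj.le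
      · obtain ⟨q, rfl⟩ := Nat.exists_eq_add_of_le hj
        rw [hoval, hTm, Nat.add_right_comm, hP, loopIdx_add_mul_period hTT (by omega)]
    · intro _ t ht
      obtain ⟨ρ, rfl⟩ := eq_add_mul_period_of_loopIdx_eq hTT hsT t ht
      have hTr : T (ρ % e) (m + ρ / e * e) = s + ρ * (T₁ - T₀) := by
        rw [hTm, ho0 _ (dvd_mul_left _ _), ← hP, Nat.mul_comm (ρ / e) e, Nat.div_add_mod]
        rfl
      refine ⟨⟨ρ % e, Nat.mod_lt _ (by omega)⟩, ⟨_, trivial, hTr⟩, ?_⟩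
      simp only
      rw [← hTr, hcnt, hmper, hfm]

open Classical in
/-- There are infinitely many instants such that the leader can repeat forever what it does between
any two of them that are far enough apart. -/
theorem BuchiPDM.exists_loop_times {Q Γ : Type*} [Finite G] [Finite Q] [Finite Γ]
    {D : BuchiPDM Q Γ (RW G)} {x : ℕ → RW G} (hx : x ∈ D.language) (reg : ℕ → G)
    (lead : ℕ → Prop) : ∃ 𝒯 : Set ℕ, (∃ᶠ t in atTop, t ∈ 𝒯) ∧ ∀ a ∈ 𝒯, ∀ᶠ b in atTop, b ∈ 𝒯 →
      reg (a - 1) = reg (b - 1) ∧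
        (fun n => x (loopIdx (Nat.count lead a) (Nat.count lead b) n)) ∈ D.language := by
  -- a leader that acts only finitely often needs no looping: `loopIdx a a` is the identity
  by_cases hl : ∃ᶠ t in atTop, lead t
  · obtain ⟨c, hc, hacc⟩ := hx
    choose τ hτ hτc using exists_count_eq_of_frequently hl
    obtain ⟨k, hk⟩ := exists_frequently_eq (frequently_isStackMin c)
      (fun d => ((c d).1, (c d).2.head?, reg (τ d - 1)))
    refine ⟨{t | ∃ d, t = τ d ∧ IsStackMin c d ∧
      ((c d).1, (c d).2.head?, reg (τ d - 1)) = k}, ?_, ?_⟩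
    · rw [frequently_atTop]
      intro B
      obtain ⟨d, hd, h⟩ := frequently_atTop.1 hk (Nat.count lead B)
      refine ⟨τ d, ?_, d, rfl, h⟩
      by_contra hcon
      have h1 := Nat.count_monotone lead (show τ d + 1 ≤ B by omega)
      rw [Nat.count_succ, if_pos (hτ d), hτc] at h1
      omega
    · rintro _ ⟨d, rfl, hd, hdk⟩
      obtain ⟨i, hi, hi'⟩ := frequently_atTop.1 hacc d
      refine eventually_atTop.2 ⟨τ i + 1, ?_⟩
      rintro _ hb ⟨d', rfl, hd', hdk'⟩
      have h1 := hdk.trans hdk'.symm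
      simp only [Prod.mk.injEq] at h1
      refine ⟨h1.2.2, ?_⟩
      rw [hτc, hτc]
      have h2 := Nat.count_monotone lead hb
      rw [Nat.count_succ, if_pos (hτ i), hτc, hτc] at h2
      exact BuchiPDM.loop_mem_language hc hd h1.1 h1.2.1 hi (by omega) hi'
  · rw [not_frequently, eventually_atTop] at hl
    obtain ⟨B, hB⟩ := hl
    obtain ⟨g, hg⟩ := exists_frequently_eq (p := fun t => B ≤ t)
      (eventually_ge_atTop B).frequently (fun t => reg (t - 1))
    refine ⟨{t | B ≤ t ∧ reg (t - 1) = g}, hg, ?_⟩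
    rintro a ⟨ha, hag⟩
    refine .of_forall ?_
    rintro b ⟨hb, hbg⟩
    refine ⟨hag.trans hbg.symm, ?_⟩
    have hcount : ∀ t, B ≤ t → Nat.count lead t = Nat.count lead B := by
      intro t ht
      induction t, ht using Nat.le_induction with
      | base => rfl
      | succ t ht ih => rw [Nat.count_succ, if_neg (hB t ht), ih, Nat.add_zero]
    rw [hcount a ha, hcount b hb]
    simpa only [loopIdx_self] using hx

open Classical in
/-- Contributors of bounded stack height can replace contributors of unbounded stack height: the
leader's run is looped, and each action of a contributor before the end of the loop gets
its own `exists_helpers`. -/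
theorem network_restriction_nonempty {QD ΓD QC ΓC : Type*} [Finite G] [Finite QD] [Finite ΓD]
    [Finite QC] [Finite ΓC] {D : BuchiPDM QD ΓD (RW G)} {C : PDM QC ΓC (RW G)} {N : ℕ}
    (hN1 : 1 ≤ N) (hN : 2 * Nat.card (QC × ΓC × QC) + 1 ≤ N)
    (h : (network D.language C.language).Nonempty) :
    (network D.language (C.restriction N hN1).language).Nonempty := by
  obtain ⟨k, hk, x, hx, v, hv, ⟨ρ⟩⟩ := exists_netRun_of_network_nonempty h
  obtain ⟨𝒯, h𝒯, hloop⟩ := BuchiPDM.exists_loop_times hx ρ.reg ρ.lead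
  -- from some instant on, only values that recur forever are in use
  have hinf : ∀ᶠ t in atTop, ∀ g, ρ.reg t = g → ∃ᶠ t' in atTop, ρ.reg t' = g := by
    rw [eventually_all]
    intro g
    by_cases hg : ∃ᶠ t' in atTop, ρ.reg t' = g
    · exact .of_forall fun _ _ => hg
    · exact (not_frequently.1 hg).mono fun t ht h => absurd h ht
  obtain ⟨B, hB⟩ := eventually_atTop.1 hinf
  choose s₀ hs₀B hs₀ using fun j =>
    PDM.exists_periodic_subword (hv j) hN1 hN (Nat.count (ρ.act j) B)
  have hlarge : ∀ᶠ t in atTop, ∀ j, (∃ᶠ t' in atTop, ρ.act j t') ∧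
      s₀ j ≤ Nat.count (ρ.act j) t ∨ ∀ t' ≥ t, ¬ ρ.act j t' := by
    rw [eventually_all]
    intro j
    by_cases hj : ∃ᶠ t' in atTop, ρ.act j t'
    · obtain ⟨t, -, ht⟩ := exists_count_eq_of_frequently hj (s₀ j)
      refine eventually_atTop.2 ⟨t, fun t' ht' => .inl ⟨hj, ?_⟩⟩
      rw [← ht]
      exact Nat.count_monotone _ ht'
    · obtain ⟨t, ht⟩ := eventually_atTop.1 (not_frequently.1 hj)
      exact eventually_atTop.2 ⟨t, fun t' ht' => .inr fun t'' ht'' => ht _ (ht'.trans ht'')⟩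
  obtain ⟨T₀, hT₀, hT₀large⟩ := (h𝒯.and_eventually hlarge).exists
  have hwin : ∀ᶠ b in atTop, ∀ g, (∃ᶠ t in atTop, ρ.reg t = g) →
      ∃ t, T₀ ≤ t ∧ t < b ∧ ρ.reg t = g := by
    rw [eventually_all]
    intro g
    by_cases hg : ∃ᶠ t' in atTop, ρ.reg t' = g
    · obtain ⟨t, ht, htg⟩ := frequently_atTop.1 hg T₀
      exact eventually_atTop.2 ⟨t + 1, fun b hb _ => ⟨t, ht, by omega, htg⟩⟩
    · exact .of_forall fun _ h => absurd h hg
  obtain ⟨T₁, hT₁, hT₁loop, hT₁win, hT₀₁⟩ := (h𝒯.and_eventually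
    ((hloop T₀ hT₀).and (hwin.and (eventually_gt_atTop T₀)))).exists
  obtain ⟨hreg, hx'⟩ := hT₁loop hT₁
  have hhelp : ∀ i : Fin k × Fin T₁, _ := fun i => exists_helpers (hs₀ i.1) (ρ.act_val i.1)
    hT₀₁ i.2.2 (by
      intro hT hact
      rcases hT₀large i.1 with ⟨hfreq, h⟩ | h
      · refine ⟨h, fun j hj => ?_⟩
        obtain ⟨t, ht, htj⟩ := exists_count_eq_of_frequently hfreq j
        rw [← htj, ρ.act_val _ _ ht]
        refine hT₁win _ (hB t ?_ _ rfl)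
        by_contra hcon
        have h1 := Nat.count_monotone (ρ.act i.1) (show t + 1 ≤ B by omega)
        rw [Nat.count_succ, if_pos ht] at h1
        have := hs₀B i.1
        omega
      · exact absurd hact (h _ hT))
  choose e he w act hwL hwval hcov using hhelp
  have hne : Nonempty (Σ i : Fin k × Fin T₁, Fin (e i)) :=
    ⟨⟨(⟨0, hk⟩, ⟨0, by omega⟩), ⟨0, he _⟩⟩⟩
  have hidx : ∀ t, ρ.lead (loopIdx T₀ T₁ t) →
      loopIdx (Nat.count ρ.lead T₀) (Nat.count ρ.lead T₁)
        (Nat.count (fun t => ρ.lead (loopIdx T₀ T₁ t)) t) =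
      Nat.count ρ.lead (loopIdx T₀ T₁ t) := by
    intro t ht
    rw [loopIdx_count_comp hT₀₁.le]
    apply loopIdx_of_lt
    have h1 := Nat.count_monotone ρ.lead (show loopIdx T₀ T₁ t + 1 ≤ T₁ from loopIdx_lt hT₀₁ t)
    rw [Nat.count_succ, if_pos ht] at h1
    omega
  exact NetRun.network_nonempty hx' (J := Σ i : Fin k × Fin T₁, Fin (e i))
    (v := fun j => w j.1 j.2) (fun j => hwL _ _)
    { reg := fun t => ρ.reg (loopIdx T₀ T₁ t)
      lead := fun t => ρ.lead (loopIdx T₀ T₁ t)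
      act := fun j => act j.1 j.2
      lead_val := fun t ht => by
        rw [hidx t ht]
        exact ρ.lead_val _ ht
      lead_read := fun t ht h => by
        rw [hidx t ht] at h
        exact (ρ.lead_read _ ht h).comp_loopIdx hreg
      act_val := fun j t ht => hwval _ _ _ ht
      covered := fun t ht => by
        obtain ⟨j, hj, hj'⟩ := ρ.covered _ ht
        obtain ⟨r, hr, hr'⟩ := hcov (j, ⟨_, loopIdx_lt hT₀₁ t⟩) hj t rfl
        refine ⟨⟨_, r⟩, hr, fun h => ?_⟩
        rw [hr'] at h
        exact (hj' h).comp_loopIdx hreg }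

theorem shuffleInf_mono {A : Type*} {L L' : Set (ℕ → A)} (h : L ⊆ L') :
    shuffleInf L ⊆ shuffleInf L' := by
  rintro z ⟨k, hk, v, hv, hz⟩
  exact ⟨k, hk, v, fun i => h (hv i), hz⟩

theorem network_mono {D L L' : Set (ℕ → RW G)} (h : L ⊆ L') : network D L ⊆ network D L' := by
  rintro u ⟨h1, y, hy, h2⟩
  exact ⟨h1, y, shuffleInf_mono h hy, h2⟩

theorem network_nonempty_iff_restriction {QD ΓD QC ΓC : Type*} [Finite G] [Finite QD] [Finite ΓD]
    [Finite QC] [Finite ΓC] (D : BuchiPDM QD ΓD (RW G)) (C : PDM QC ΓC (RW G)) :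
    (network D.language C.language).Nonempty ↔
      (network D.language (C.restriction (2 * Nat.card QC ^ 2 * Nat.card ΓC + 1)
        (Nat.le_add_left 1 _)).language).Nonempty := by
  refine ⟨fun h => network_restriction_nonempty _ ?_ h,
    fun h => h.mono (network_mono PDM.restriction_language_subset)⟩
  rw [Nat.card_prod, Nat.card_prod]
  apply le_of_eq
  ring

end Loop

/-! ### A contributor that needs a high stack -/

section LowerBound

/-- The rules of the contributor of the lower bound, on natural numbers. The bottom symbol is `0`,
the other stack symbols are `1, …, M`, and `M` is a marker. In the states `a < k` the machine
pushes, periodically, `k` copies of each of `1, …, M - 1` and then one marker. On top of a marker it may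
turn to popping. It is in state `k + j` when it has popped `j` markers, and at most `k`
of them can be popped. If it finds the bottom symbol after popping exactly `k` markers, it writes
the value `2`, and reads `2` forever. Before that it reads `1` when it pushes a marker and
`0` otherwise. -/
inductive CounterRule (k M : ℕ) : ℕ → RW (Fin 3) → ℕ → ℕ → Option ℕ → Prop
  | start (γ : ℕ) (h : γ = 0 ∨ γ = M) : CounterRule k M 0 (RWKind.read, 0) γ 0 (some 1)
  | stay (a γ : ℕ) (ha : a + 1 < k) (h : 1 ≤ γ) (h' : γ < M) :
      CounterRule k M a (RWKind.read, 0) γ (a + 1) (some γ)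
  | next (a γ : ℕ) (ha : a + 1 = k) (h : 1 ≤ γ) (h' : γ + 1 < M) :
      CounterRule k M a (RWKind.read, 0) γ 0 (some (γ + 1))
  | mark (a γ : ℕ) (ha : a + 1 = k) (h : 1 ≤ γ) (h' : γ + 1 = M) :
      CounterRule k M a (RWKind.read, 1) γ 0 (some M)
  | turn : CounterRule k M 0 (RWKind.read, 0) M (k + 1) none
  | pop (j γ : ℕ) (hj : 1 ≤ j) (hjk : j ≤ k) (h : 1 ≤ γ) (h' : γ < M) :
      CounterRule k M (k + j) (RWKind.read, 0) γ (k + j) none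
  | popMark (j : ℕ) (hj : 1 ≤ j) (hjk : j < k) :
      CounterRule k M (k + j) (RWKind.read, 0) M (k + (j + 1)) none
  | finish : CounterRule k M (k + k) (RWKind.write, 2) 0 (k + k + 1) (some 1)
  | loop (γ : ℕ) : CounterRule k M (k + k + 1) (RWKind.read, 2) γ (k + k + 1) (some 1)

/-- The transitions given by `CounterRule`, on configurations with natural numbers as states and
stack symbols. -/
inductive CounterStep (k M : ℕ) : ℕ × List ℕ → RW (Fin 3) → ℕ × List ℕ → Prop
  | pop {q : ℕ} {a : RW (Fin 3)} {γ q' : ℕ} (w : List ℕ) (h : CounterRule k M q a γ q' none) :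
      CounterStep k M (q, γ :: w) a (q', w)
  | push {q : ℕ} {a : RW (Fin 3)} {γ q' γ' : ℕ} (w : List ℕ)
      (h : CounterRule k M q a γ q' (some γ')) : CounterStep k M (q, γ :: w) a (q', γ' :: γ :: w)

/-- The contributor of the lower bound, with `n + 1` states and `m + 1` stack symbols. -/
def counterPDM (k M n m : ℕ) : PDM (Fin (n + 1)) (Fin (m + 1)) (RW (Fin 3)) where
  bot := 0
  rules := {τ | CounterRule k M τ.1.val τ.2.1 τ.2.2.1.val τ.2.2.2.1.val
    (τ.2.2.2.2.map fun γ => γ.1.val)}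
  init := 0

variable {k M n m : ℕ}

theorem CounterRule.target_le {q : ℕ} {a : RW (Fin 3)} {γ q' : ℕ} {x : Option ℕ}
    (h : CounterRule k M q a γ q' x) : q' ≤ 2 * k + 1 := by
  cases h <;> omega

theorem CounterRule.pushed {q : ℕ} {a : RW (Fin 3)} {γ q' γ' : ℕ} (hM : 2 ≤ M)
    (h : CounterRule k M q a γ q' (some γ')) : 1 ≤ γ' ∧ γ' ≤ M := by
  cases h <;> omega

theorem counterStep_of_step {c c' : Fin (n + 1) × List (Fin (m + 1))} {a : RW (Fin 3)}
    (h : (counterPDM k M n m).Step c a c') :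
    CounterStep k M (c.1.val, c.2.map Fin.val) a (c'.1.val, c'.2.map Fin.val) := by
  cases h with
  | pop w h => exact .pop _ h
  | push w h => exact .push _ h

theorem exists_step_of_counterStep (hM : 2 ≤ M) (hn : 2 * k + 1 ≤ n) (hm : M ≤ m)
    {c c' : ℕ × List ℕ} {a : RW (Fin 3)} {d : Fin (n + 1) × List (Fin (m + 1))}
    (h : CounterStep k M c a c') (hd : (d.1.val, d.2.map Fin.val) = c) :
    ∃ d', (counterPDM k M n m).Step d a d' ∧ (d'.1.val, d'.2.map Fin.val) = c' := by
  obtain ⟨q, w⟩ := d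
  subst hd
  generalize hw' : w.map Fin.val = w' at h
  simp only at h
  cases h with
  | @pop _ _ _ q' w₁ h =>
    obtain ⟨γ, w, rfl, rfl, rfl⟩ := List.map_eq_cons_iff.1 hw'
    exact ⟨(⟨q', by have := h.target_le; omega⟩, w), .pop w h, rfl⟩
  | @push _ _ _ q' γ' w₁ h =>
    obtain ⟨γ, w, rfl, rfl, rfl⟩ := List.map_eq_cons_iff.1 hw'
    have hγ' := h.pushed hM
    have h0 : (⟨γ', by omega⟩ : Fin (m + 1)) ≠ (counterPDM k M n m).bot := by
      intro h0
      have := congrArg Fin.val h0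
      simp [counterPDM] at this
      omega
    exact ⟨(⟨q', by have := h.target_le; omega⟩, _),
      .push (γ' := ⟨⟨γ', by omega⟩, h0⟩) w (by exact h), rfl⟩

/-- The number of pushes since the last marker, as the state `q` and the topmost symbol tell. -/
def pushOffset (k M q : ℕ) : List ℕ → ℕ
  | [] => 0
  | γ :: _ => if γ = 0 ∨ γ = M then 0 else (γ - 1) * k + q + 1

/-- The invariant of the runs of the contributor with stack height at most `N`. As long as the
bottom symbol has not been forgotten, a period of `(M - 1) * k + 1` symbols is on the stack
for every marker on the stack. Hence the markers that are still on the stack or have been popped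
account for at most `N` symbols, and the last state is reached only if `k` periods do. -/
def CounterInv (k M N : ℕ) (c : ℕ × List ℕ) : Prop :=
  (c.1 < k → ∀ w₁ w₂, c.2 = w₁ ++ 0 :: w₂ →
    ((M - 1) * k + 1) * w₁.count M + pushOffset k M c.1 c.2 ≤ w₁.length) ∧
  (∀ j, c.1 = k + j → j ≤ k → ∀ w₁ w₂, c.2 = w₁ ++ 0 :: w₂ →
    ((M - 1) * k + 1) * (j + w₁.count M) ≤ N) ∧
  (2 * k < c.1 → ((M - 1) * k + 1) * k ≤ N)

theorem CounterStep.inv (hM : 2 ≤ M) (hk : 1 ≤ k) {N : ℕ} {c c' : ℕ × List ℕ} {a : RW (Fin 3)}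
    (h : CounterStep k M c a c') (hc : CounterInv k M N c) (hN : c.2.length ≤ N) :
    CounterInv k M N c' := by
  obtain ⟨h1, h2, h3⟩ := hc
  have hpush : ∀ {γ γ' : ℕ} {w w₁ w₂ : List ℕ}, 1 ≤ γ' → γ' :: γ :: w = w₁ ++ 0 :: w₂ →
      ∃ w₃, w₁ = γ' :: w₃ ∧ γ :: w = w₃ ++ 0 :: w₂ := by
    intro γ γ' w w₁ w₂ hγ' hw
    obtain _ | ⟨γ'', w₃⟩ := w₁
    · simp only [List.nil_append, List.cons.injEq] at hw; omega
    · simp only [List.cons_append, List.cons.injEq] at hw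
      exact ⟨w₃, by rw [hw.1], hw.2⟩
  cases h with
  | @push q a γ q' γ' w h =>
    have hγ' := (h.pushed hM).1
    cases h with
    | start _ hγ =>
      refine ⟨fun _ w₁ w₂ hw => ?_, fun j hj => by omega, fun h => by simp at h⟩
      obtain ⟨w₃, rfl, hw'⟩ := hpush hγ' hw
      have := h1 (by simp only; omega) _ _ hw'
      simp only [List.count_cons, List.length_cons, pushOffset, beq_iff_eq] at this ⊢
      grind
    | stay _ _ ha hγ hγM =>
      refine ⟨fun _ w₁ w₂ hw => ?_, fun j hj => by simp only at hj; omega, fun h => by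
        simp only at h; omega⟩
      obtain ⟨w₃, rfl, hw'⟩ := hpush hγ' hw
      have := h1 (by simp only; omega) _ _ hw'
      simp only [List.count_cons, List.length_cons, pushOffset, beq_iff_eq] at this ⊢
      grind
    | next _ _ ha hγ hγM =>
      refine ⟨fun _ w₁ w₂ hw => ?_, fun j hj => by simp only at hj; omega, fun h => by
        simp only at h; omega⟩
      obtain ⟨w₃, rfl, hw'⟩ := hpush hγ' hw
      have := h1 (by simp only; omega) _ _ hw'
      obtain ⟨g, rfl⟩ := Nat.exists_eq_add_of_le' hγ
      have e : (g + 1) * k = g * k + k := Nat.succ_mul _ _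
      simp only [List.count_cons, List.length_cons, pushOffset, beq_iff_eq,
        Nat.add_sub_cancel] at this ⊢
      grind
    | mark _ _ ha hγ hγM =>
      refine ⟨fun _ w₁ w₂ hw => ?_, fun j hj => by simp only at hj; omega, fun h => by
        simp only at h; omega⟩
      obtain ⟨w₃, rfl, hw'⟩ := hpush hγ' hw
      have := h1 (by simp only; omega) _ _ hw'
      obtain ⟨g, rfl⟩ := Nat.exists_eq_add_of_le' hγ
      subst hγM
      have e : (g + 1) * k = g * k + k := Nat.succ_mul _ _
      simp only [List.count_cons_self, List.length_cons, pushOffset, Nat.add_sub_cancel,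
        Nat.mul_succ] at this ⊢
      rw [if_neg (by omega)] at this
      simp only [or_true, if_true]
      omega
    | finish =>
      have := h2 k rfl le_rfl [] w rfl
      simp only [List.count_nil, Nat.add_zero] at this
      exact ⟨fun h => by simp only at h; omega, fun j hj hjk => by simp only at hj; omega,
        fun _ => this⟩
    | loop =>
      exact ⟨fun h => by simp only at h; omega, fun j hj hjk => by simp only at hj; omega,
        fun _ => h3 (by simp only; omega)⟩
  | @pop q a γ q' w h =>
    cases h with
    | turn =>
      refine ⟨fun h => by simp only at h; omega, fun j hj hjk w₁ w₂ hw => ?_,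
        fun h => by simp only at h ⊢; omega⟩
      simp only at hj hw
      obtain rfl : j = 1 := by omega
      have := h1 (by simp only; omega) (M :: w₁) w₂ (by simp [hw])
      simp only [hw, List.count_cons_self, List.length_cons, List.length_append] at this hN
      rw [Nat.add_comm 1]
      omega
    | pop j _ hj hjk hγ hγM =>
      refine ⟨fun h => by simp only at h; omega, fun j' hj' hjk w₁ w₂ hw => ?_,
        fun h => by simp only at h; omega⟩
      have := h2 j' hj' hjk (γ :: w₁) w₂ (by simpa using hw)
      rwa [List.count_cons_of_ne (by omega)] at this
    | popMark j hj hjk =>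
      refine ⟨fun h => by simp only at h; omega, fun j' hj' _ w₁ w₂ hw => ?_,
        fun h => by simp only at h; omega⟩
      simp only at hj'
      obtain rfl : j' = j + 1 := by omega
      have := h2 j rfl hjk.le (M :: w₁) w₂ (by simpa using hw)
      rwa [List.count_cons_self, ← Nat.add_assoc, Nat.add_right_comm] at this

theorem CounterInv.of_prefix {N q : ℕ} {w u : List ℕ} (h : CounterInv k M N (q, w)) (hu : u <+: w)
    (hu0 : u ≠ []) : CounterInv k M N (q, u) := by
  obtain ⟨z, rfl⟩ := hu
  obtain ⟨h1, h2, h3⟩ := h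
  refine ⟨fun hq w₁ w₂ hw => ?_, fun j hj hjk w₁ w₂ hw => ?_, h3⟩
  · have := h1 hq w₁ (w₂ ++ z) (by simp only at hw; simp [hw])
    obtain ⟨γ, u, rfl⟩ := List.exists_cons_of_ne_nil hu0
    exact this
  · exact h2 j hj hjk w₁ (w₂ ++ z) (by simp only at hw; simp [hw])

theorem CounterStep.target_of_val_two {c c' : ℕ × List ℕ} {a : RW (Fin 3)}
    (h : CounterStep k M c a c') (ha : a.2 = 2) : 2 * k < c'.1 := by
  cases h with
  | pop _ h => cases h <;> simp at ha
  | push _ h => cases h <;> first | (simp at ha; done) | (simp only; omega)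

theorem CounterStep.val_of_write {c c' : ℕ × List ℕ} {a : RW (Fin 3)}
    (h : CounterStep k M c a c') (ha : a.1 = RWKind.write) : a.2 = 2 := by
  cases h with
  | pop _ h => cases h <;> simp at ha
  | push _ h => cases h <;> first | rfl | simp at ha

/-- In a stack of height `N` there is no room for the `k` periods that must be pushed above the
bottom symbol before the value `2` can be written. -/
theorem counterPDM_restriction_val_ne (hM : 2 ≤ M) (hk : 1 ≤ k) {N : ℕ} (hN : 1 ≤ N)
    (hlt : N < ((M - 1) * k + 1) * k) {v : ℕ → RW (Fin 3)}
    (hv : v ∈ ((counterPDM k M n m).restriction N hN).language) (i : ℕ) : (v i).2 ≠ 2 := by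
  obtain ⟨r, h0, hr⟩ := PDM.restriction_run_dropStep hv
  have hlen : ∀ i, (r i).2.length ≤ N := by
    rintro (_ | i)
    · rw [h0]; exact hN
    · exact (hr i).2
  have hinv : ∀ i, CounterInv k M N ((r i).1.val, (r i).2.map Fin.val) := by
    intro i
    induction i with
    | zero =>
      rw [h0]
      refine ⟨fun _ w₁ w₂ hw => ?_, fun j hj => ?_, fun h => ?_⟩
      · obtain _ | ⟨γ, w₁⟩ := w₁
        · simp [counterPDM, pushOffset]
        · simp [counterPDM] at hw
      · simp [counterPDM] at hj; omega
      · simp [counterPDM] at h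
    | succ i ih =>
      obtain ⟨⟨h1, w, h2, h3⟩, _⟩ := hr i
      exact ((counterStep_of_step h2).inv hM hk ih (by simpa using hlen i)).of_prefix
        (h3.map _) (by simpa using h1)
  intro h2
  have h3 := (hinv (i + 1)).2.2
  obtain ⟨⟨_, w, h4, _⟩, _⟩ := hr i
  have h5 := counterStep_of_step h4
  exact absurd (h3 (h5.target_of_val_two h2)) (by omega)

theorem counterPDM_write {v : ℕ → RW (Fin 3)} (hv : v ∈ (counterPDM k M n m).language) (i : ℕ)
    (h : (v i).1 = RWKind.write) : (v i).2 = 2 := by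
  obtain ⟨c, -, hc⟩ := hv
  exact (counterStep_of_step (hc i)).val_of_write h

/-- In every run of the contributor, the letters change their values again and again until `2` is
written. Reading `0` forever is impossible since a pushing phase has to read `1` in every
period, and a popping phase is finite. -/
theorem counterPDM_not_eventually_const (hM : 2 ≤ M) (hk : 1 ≤ k) {v : ℕ → RW (Fin 3)}
    (hv : v ∈ (counterPDM k M n m).language) (h2 : ∀ i, (v i).2 ≠ 2) (B : ℕ) (g : Fin 3) :
    ¬ ∀ i ≥ B, (v i).2 = g := by
  intro hg
  obtain ⟨c, -, hc⟩ := hv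
  let d : ℕ → ℕ × List ℕ := fun i => ((c i).1.val, (c i).2.map Fin.val)
  have hd : ∀ i, CounterStep k M (d i) (v i) (d (i + 1)) := fun i => counterStep_of_step (hc i)
  have hg01 : g = 0 ∨ g = 1 := by
    have := h2 B
    rw [hg B le_rfl] at this
    omega
  rcases hg01 with rfl | rfl
  · -- reading `0`, pushing gets closer to the next marker, and popping lowers the stack
    let μ : ℕ × List ℕ → ℕ × ℕ := fun c =>
      if c.1 < k then (1, (M - 1) * k + 1 - pushOffset k M c.1 c.2) else (0, c.2.length)
    obtain ⟨i, hi⟩ := WellFounded.not_rel_apply_succ (r := Prod.Lex (· < ·) (· < ·))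
      (fun i => μ (d (B + i)))
    apply hi
    have h1 := hd (B + i)
    have h0 := hg (B + i) (by omega)
    simp only [← Nat.add_assoc]
    generalize d (B + i) = x at h1
    generalize d (B + i + 1) = y at h1
    generalize v (B + i) = a at h0 h1
    cases h1 with
    | @pop q a γ q' w h =>
      cases h with
      | turn =>
        simp only [μ, show ¬ k + 1 < k by omega, show 0 < k by omega, if_true, if_false]
        exact Prod.Lex.left _ _ (by omega)
      | pop j γ =>
        simp only [μ, show ¬ k + j < k by omega, if_false]
        exact Prod.Lex.right _ (by simp)
      | popMark j =>
        simp only [μ, show ¬ k + j < k by omega, show ¬ k + (j + 1) < k by omega, if_false]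
        exact Prod.Lex.right _ (by simp)
    | @push q a γ q' γ' w h =>
      cases h with
      | start _ hγ =>
        simp only [μ, show 0 < k by omega, if_true]
        refine Prod.Lex.right _ ?_
        simp only [pushOffset, hγ, if_true]
        rw [if_neg (by omega)]
        omega
      | stay _ _ ha hγ hγM =>
        simp only [μ, show q < k by omega, ha, if_true]
        refine Prod.Lex.right _ ?_
        simp only [pushOffset, show ¬ (γ = 0 ∨ γ = M) by omega, if_false]
        have e : (γ - 1 + 1) * k ≤ (M - 1) * k := Nat.mul_le_mul_right _ (by omega)
        rw [Nat.succ_mul] at e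
        omega
      | next _ _ ha hγ hγM =>
        simp only [μ, show q < k by omega, show 0 < k by omega, if_true]
        refine Prod.Lex.right _ ?_
        simp only [pushOffset, show ¬ (γ = 0 ∨ γ = M) by omega,
          show ¬ (γ + 1 = 0 ∨ γ + 1 = M) by omega, if_false]
        have e : (γ - 1 + 1) * k ≤ (M - 1) * k := Nat.mul_le_mul_right _ (by omega)
        have e' : (γ + 1 - 1) * k = (γ - 1 + 1) * k := by congr 1; omega
        rw [Nat.succ_mul] at e e'
        omega
      | mark => simp at h0
      | finish => simp at h0
      | loop => simp at h0
  · have h1 := hd B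
    have h1' := hd (B + 1)
    have e := hg B le_rfl
    have e' := hg (B + 1) (by omega)
    generalize d B = x at h1
    generalize d (B + 1) = y at h1 h1'
    generalize d (B + 1 + 1) = z at h1'
    generalize v B = a at h1 e
    generalize v (B + 1) = a' at h1' e'
    cases h1 with
    | pop w h => cases h <;> simp at e
    | @push q a γ q' γ' w h =>
      cases h with
      | mark _ γ ha hγ hγM =>
        generalize hx : ((0 : ℕ), M :: γ :: w) = x at h1'
        cases h1' with
        | pop w h => cases h <;> simp at e'
        | push w h =>
          cases h <;> first | (simp only [Prod.mk.injEq, List.cons.injEq] at hx; omega) | simp at e'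
      | start => simp at e
      | stay => simp at e
      | next => simp at e
      | finish => simp at e
      | loop => simp at e

/-! ### The contributor can write with a high stack -/

/-- The transitions of the contributor before it writes. -/
def SilentStep (k M : ℕ) (c : ℕ × List ℕ) (a : RW (Fin 3)) (c' : ℕ × List ℕ) : Prop :=
  CounterStep k M c a c' ∧ a.2 ≠ 2

theorem SilentStep.push {q : ℕ} {a : RW (Fin 3)} {γ q' γ' : ℕ} (w : List ℕ)
    (h : CounterRule k M q a γ q' (some γ')) (ha : a.2 ≠ 2) :
    LPath (SilentStep k M) (q, γ :: w) [a] (q', γ' :: γ :: w) := .single ⟨.push w h, ha⟩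

theorem SilentStep.pop {q : ℕ} {a : RW (Fin 3)} {γ q' : ℕ} (w : List ℕ)
    (h : CounterRule k M q a γ q' none) (ha : a.2 ≠ 2) :
    LPath (SilentStep k M) (q, γ :: w) [a] (q', w) := .single ⟨.pop w h, ha⟩

theorem exists_path_copies {γ : ℕ} (hγ : 1 ≤ γ) (hγM : γ < M) (w : List ℕ) :
    ∀ a < k, ∃ l, LPath (SilentStep k M) (0, γ :: w) l (a, γ :: (List.replicate a γ ++ w)) := by
  intro a
  induction a with
  | zero => exact fun _ => ⟨_, .nil _⟩
  | succ a ih =>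
    intro ha
    obtain ⟨l, hl⟩ := ih (by omega)
    exact ⟨_, hl.append (SilentStep.push _ (.stay a γ ha hγ hγM) (by simp))⟩

theorem exists_path_climb (hk : 1 ≤ k) (w : List ℕ) (γ : ℕ) (hγ : 1 ≤ γ) :
    γ < M → ∃ l u, (∀ x ∈ u, 1 ≤ x ∧ x < M) ∧
      LPath (SilentStep k M) (0, 1 :: w) l (0, γ :: (u ++ w)) := by
  induction γ, hγ using Nat.le_induction with
  | base => exact fun _ => ⟨_, [], by simp, .nil _⟩
  | succ γ hγ ih =>
    intro hγM
    obtain ⟨l, u, hu, hl⟩ := ih (by omega)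
    obtain ⟨l', hl'⟩ := exists_path_copies (k := k) hγ (show γ < M by omega) (u ++ w) (k - 1)
      (by omega)
    have h := (hl.append hl').append
      (SilentStep.push _ (.next (k - 1) γ (by omega) hγ hγM) (by simp))
    refine ⟨_, γ :: (List.replicate (k - 1) γ ++ u), ?_, by simpa using h⟩
    intro x hx
    simp only [List.mem_cons, List.mem_append, List.mem_replicate] at hx
    rcases hx with rfl | ⟨_, rfl⟩ | hx
    · omega
    · omega
    · exact hu x hx

/-- One period of pushing, from one marker, or the bottom symbol, to the next marker. -/
theorem exists_path_period (hM : 2 ≤ M) (hk : 1 ≤ k) {γ : ℕ} (hγ : γ = 0 ∨ γ = M) (w : List ℕ) :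
    ∃ l u, (RWKind.read, 1) ∈ l ∧ (∀ x ∈ u, 1 ≤ x ∧ x < M) ∧
      LPath (SilentStep k M) (0, γ :: w) l (0, M :: (u ++ γ :: w)) := by
  obtain ⟨l, u, hu, hl⟩ := exists_path_climb (M := M) hk (γ :: w) (M - 1) (by omega) (by omega)
  obtain ⟨l', hl'⟩ := exists_path_copies (k := k) (γ := M - 1) (M := M) (by omega) (by omega)
    (u ++ γ :: w) (k - 1) (by omega)
  have h := (((SilentStep.push w (.start γ hγ) (by simp)).append hl).append hl').append
    (SilentStep.push _ (.mark (k - 1) (M - 1) (by omega) (by omega) (by omega)) (by simp))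
  refine ⟨_, (M - 1) :: (List.replicate (k - 1) (M - 1) ++ u), ?_, ?_, by simpa using h⟩
  · simp
  · intro x hx
    simp only [List.mem_cons, List.mem_append, List.mem_replicate] at hx
    rcases hx with rfl | ⟨_, rfl⟩ | hx
    · omega
    · omega
    · exact hu x hx

theorem exists_path_pop {j : ℕ} (hj : 1 ≤ j) (hjk : j ≤ k) (w : List ℕ) :
    ∀ u : List ℕ, (∀ x ∈ u, 1 ≤ x ∧ x < M) →
      ∃ l, LPath (SilentStep k M) (k + j, u ++ w) l (k + j, w) := by
  intro u
  induction u with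
  | nil => exact fun _ => ⟨_, .nil _⟩
  | cons x u ih =>
    intro h
    obtain ⟨l, hl⟩ := ih fun y hy => h y (by simp [hy])
    have hx := h x (by simp)
    exact ⟨_, (SilentStep.pop _ (.pop j x hj hjk hx.1 hx.2) (by simp)).append hl⟩

/-- The contributor can push `z + 1` markers and then, after popping the last of them, pop
everything that is left. -/
theorem exists_path_markers (hM : 2 ≤ M) (hk : 1 ≤ k) (z : ℕ) :
    ∃ l u, (RWKind.read, 1) ∈ l ∧ LPath (SilentStep k M) (0, [0]) l (0, M :: u) ∧
      ∀ j, 1 ≤ j → j + z ≤ k → ∃ l', LPath (SilentStep k M) (k + j, u) l' (k + (j + z), [0]) := by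
  induction z with
  | zero =>
    obtain ⟨l, u, h1, hu, hl⟩ := exists_path_period hM hk (.inl rfl) []
    exact ⟨l, _, h1, hl, fun j hj hjk => exists_path_pop hj hjk [0] u hu⟩
  | succ z ih =>
    obtain ⟨l, u, h1, hl, hpop⟩ := ih
    obtain ⟨l', u', -, hu', hl'⟩ := exists_path_period hM hk (.inr rfl) u
    refine ⟨l ++ l', _, by simp [h1], hl.append hl', fun j hj hjz => ?_⟩
    obtain ⟨l₁, hl₁⟩ := exists_path_pop (k := k) hj (by omega) (M :: u) u' hu'
    obtain ⟨l₂, hl₂⟩ := hpop (j + 1) (by omega) (by omega)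
    have h := (hl₁.append (SilentStep.pop _ (.popMark j hj (by omega)) (by simp))).append hl₂
    rw [show k + (j + 1 + z) = k + (j + (z + 1)) by omega] at h
    exact ⟨_, h⟩

theorem exists_path_to_write (hM : 2 ≤ M) (hk : 1 ≤ k) :
    ∃ l, (RWKind.read, 0) ∈ l ∧ (RWKind.read, 1) ∈ l ∧
      LPath (SilentStep k M) (0, [0]) l (k + k, [0]) := by
  obtain ⟨l, u, h1, hl, hpop⟩ := exists_path_markers hM hk (k - 1)
  obtain ⟨l', hl'⟩ := hpop 1 le_rfl (by omega)
  rw [show k + (1 + (k - 1)) = k + k by omega] at hl'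
  exact ⟨_, by simp, by simp [h1], (hl.append (SilentStep.pop u .turn (by simp))).append hl'⟩

/-- A word of the contributor that writes `2`. -/
theorem exists_counterPDM_word (hM : 2 ≤ M) (hk : 1 ≤ k) (hn : 2 * k + 1 ≤ n) (hm : M ≤ m) :
    ∃ v ∈ (counterPDM k M n m).language, ∃ T, (∀ i < T, (v i).2 ≠ 2) ∧ v T = (RWKind.write, 2) ∧
      (∀ i > T, (v i).2 = 2) ∧ (∃ i, (v i).2 = 0) ∧ ∃ i, (v i).2 = 1 := by
  obtain ⟨l, h0, h1, hl⟩ := exists_path_to_write hM hk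
  obtain ⟨s, hs0, hsl, hs⟩ := hl.exists_states
  let v : ℕ → RW (Fin 3) := fun i =>
    if h : i < l.length then l[i] else if i = l.length then (RWKind.write, 2) else (RWKind.read, 2)
  have hvl : ∀ i (h : i < l.length), v i = l[i] := fun i h => by simp only [v, h, dif_pos]
  let r : ℕ → ℕ × List ℕ := fun i =>
    if i ≤ l.length then s i else (k + k + 1, List.replicate (i - l.length) 1 ++ [0])
  have hr : ∀ i, CounterStep k M (r i) (v i) (r (i + 1)) := by
    intro i
    rcases lt_trichotomy i l.length with h | h | h
    · rw [hvl i h]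
      simp only [r, h.le, show i + 1 ≤ l.length from h, if_true]
      exact (hs i h).1
    · subst h
      simp only [r, v, le_rfl, if_true, lt_irrefl, dif_neg, not_false_eq_true, hsl,
        show ¬ l.length + 1 ≤ l.length by omega, if_false, Nat.add_sub_cancel_left]
      exact .push [] .finish
    · obtain ⟨d, rfl⟩ := Nat.exists_eq_add_of_lt h
      simp only [r, v, show ¬ l.length + d + 1 ≤ l.length by omega,
        show ¬ l.length + d + 1 + 1 ≤ l.length by omega,
        show ¬ l.length + d + 1 < l.length by omega,
        show ¬ l.length + d + 1 = l.length by omega, if_false, dif_neg, not_false_eq_true,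
        show l.length + d + 1 - l.length = d + 1 by omega,
        show l.length + d + 1 + 1 - l.length = d + 1 + 1 by omega, List.replicate_succ,
        List.cons_append]
      exact .push _ (.loop 1)
  obtain ⟨c, hc0, hc⟩ := exists_run_of_simulation (S := CounterStep k M)
    (S' := (counterPDM k M n m).Step) (R := fun c d => (d.1.val, d.2.map Fin.val) = c)
    (fun h hd => exists_step_of_counterStep hM hn hm h hd) hr
    (d := ((counterPDM k M n m).init, [(counterPDM k M n m).bot]))
    (by simp [r, hs0, counterPDM])
  refine ⟨v, ⟨c, hc0, fun i => (hc i).1⟩, l.length, ?_, by simp [v], ?_, ?_, ?_⟩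
  · intro i hi
    rw [hvl i hi]
    exact (hs i hi).2
  · intro i hi
    simp [v, show ¬ i < l.length by omega, show i ≠ l.length by omega]
  · obtain ⟨i, hi, h⟩ := List.getElem_of_mem h0
    exact ⟨i, by rw [hvl i hi, h]⟩
  · obtain ⟨i, hi, h⟩ := List.getElem_of_mem h1
    exact ⟨i, by rw [hvl i hi, h]⟩

end LowerBound

/-! ### A leader that waits for the value `2` -/

section Leader

/-- The leader that writes the values `y 0, …, y (T - 1)` and then reads the value `2` forever. It
pushes the symbol `1` in every step. -/
def scriptLeader (T : ℕ) (y : ℕ → Fin 3) : BuchiPDM (Fin (T + 1)) (Fin 2) (RW (Fin 3)) where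
  bot := 0
  rules := {τ | τ.2.2.2.2 = some ⟨1, by decide⟩ ∧
    ((τ.1.val < T ∧ τ.2.1 = (RWKind.write, y τ.1.val) ∧ τ.2.2.2.1.val = τ.1.val + 1) ∨
      (τ.1.val = T ∧ τ.2.1 = (RWKind.read, 2) ∧ τ.2.2.2.1.val = T))}
  init := 0
  accepting := Set.univ

/-- The only word of `scriptLeader T y`. -/
def scriptWord (T : ℕ) (y : ℕ → Fin 3) (i : ℕ) : RW (Fin 3) :=
  if i < T then (RWKind.write, y i) else (RWKind.read, 2)

theorem mem_scriptLeader_language {T : ℕ} {y : ℕ → Fin 3} {x : ℕ → RW (Fin 3)} :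
    x ∈ (scriptLeader T y).language ↔ x = scriptWord T y := by
  constructor
  · rintro ⟨c, ⟨hc0, hc⟩, -⟩
    have hrule : ∀ i, ((c i).1.val < T ∧ x i = (RWKind.write, y (c i).1.val) ∧
        (c (i + 1)).1.val = (c i).1.val + 1) ∨
        ((c i).1.val = T ∧ x i = (RWKind.read, 2) ∧ (c (i + 1)).1.val = T) := by
      intro i
      have h := hc i
      generalize c i = d at h ⊢
      generalize c (i + 1) = d' at h ⊢
      cases h with
      | pop w h => exact absurd h.1 (by simp)
      | push w h => exact h.2
    have hst : ∀ i, (c i).1.val = min i T := by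
      intro i
      induction i with
      | zero => simp [hc0, scriptLeader]
      | succ i ih =>
        rcases hrule i with ⟨h1, -, h2⟩ | ⟨h1, -, h2⟩ <;> omega
    funext i
    simp only [scriptWord]
    rcases hrule i with ⟨h1, h2, -⟩ | ⟨h1, h2, -⟩
    · have := hst i
      rw [if_pos (by omega), h2, show (c i).1.val = i by omega]
    · have := hst i
      rw [if_neg (by omega), h2]
  · rintro rfl
    refine ⟨fun i => (⟨min i T, by omega⟩, List.replicate i 1 ++ [0]), ⟨rfl, fun i => ?_⟩,
      .of_forall fun _ => mem_univ _⟩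
    have h10 : (1 : Fin 2) ≠ (scriptLeader T y).bot := by simp [scriptLeader]
    have hrule : ∀ γ, ((⟨min i T, by omega⟩ : Fin (T + 1)), scriptWord T y i, γ,
        (⟨min (i + 1) T, by omega⟩ : Fin (T + 1)), some ⟨1, h10⟩) ∈
          (scriptLeader T y).rules := by
      intro γ
      refine ⟨rfl, ?_⟩
      simp only [scriptWord]
      by_cases h : i < T
      · exact .inl ⟨by omega, by rw [if_pos h, min_eq_left h.le], by omega⟩
      · exact .inr ⟨by omega, by rw [if_neg h], by omega⟩
    obtain _ | i := i
    · exact .push [] (hrule 0)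
    · simp only [List.replicate_succ, List.cons_append]
      exact .push (List.replicate i 1 ++ [0]) (hrule 1)

open Classical in
/-- If the leader copies the values of a contributor up to its first `2`, then the leader and this
contributor can run in lockstep. -/
theorem network_scriptLeader_nonempty {L : Set (ℕ → RW (Fin 3))} {v : ℕ → RW (Fin 3)} (hv : v ∈ L)
    {T : ℕ} (hT : v T = (RWKind.write, 2)) (hT' : ∀ i > T, (v i).2 = 2) :
    (network (scriptLeader T fun i => (v i).2).language L).Nonempty := by
  have hlt : ∀ (_ : DecidablePred fun t => t ≠ T) t, t ≤ T → Nat.count (fun t => t ≠ T) t = t :=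
    fun _ t ht => Nat.count_of_forall fun i hi => by omega
  have hge : ∀ (_ : DecidablePred fun t => t ≠ T) t, T < t →
      T ≤ Nat.count (fun t => t ≠ T) t := fun i t ht =>
    (hlt i T le_rfl).symm.le.trans (Nat.count_monotone _ ht.le)
  have htrue : ∀ (i : DecidablePred fun _ : ℕ => True) t, @Nat.count (fun _ => True) i t = t :=
    fun i t => @Nat.count_of_forall (fun _ => True) i t fun _ _ => trivial
  exact NetRun.network_nonempty (J := Unit) (mem_scriptLeader_language.2 rfl) (v := fun _ => v)
    (fun _ => hv)
    { reg := fun t => (v t).2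
      lead := fun t => t ≠ T
      act := fun _ _ => True
      lead_val := fun t ht => by
        simp only [scriptWord]
        rcases lt_or_gt_of_ne ht with h | h
        · rw [hlt _ t h.le, if_pos h]
        · rw [if_neg (hge _ t h).not_gt, hT' t h]
      lead_read := fun t ht hr => by
        rcases lt_or_gt_of_ne ht with h | h
        · simp only [scriptWord] at hr
          rw [hlt _ t h.le, if_pos h] at hr
          cases hr
        · obtain ⟨s, rfl⟩ := Nat.exists_eq_add_of_lt h
          refine ⟨T + s, rfl, ?_⟩
          simp only
          rw [hT' _ h]
          obtain _ | s := s
          · rw [Nat.add_zero, hT]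
          · rw [hT' _ (by omega)]
      act_val := fun _ t _ => by rw [htrue]
      covered := fun t ht => by
        obtain rfl : t = T := not_not.1 ht
        refine ⟨(), trivial, fun h => ?_⟩
        rw [htrue, hT] at h
        cases h }

open Classical in
/-- If the contributors can neither write a value other than `2` nor get to `2`, and cannot read the
same value forever, then the leader waits for `2` in vain, and the network stops. -/
theorem network_scriptLeader_not_nonempty {L : Set (ℕ → RW (Fin 3))} {T : ℕ} {y : ℕ → Fin 3}
    (hy : ∀ i < T, y i ≠ 2) (h2 : ∀ v ∈ L, ∀ i, (v i).2 ≠ 2)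
    (hwrite : ∀ v ∈ L, ∀ i, (v i).1 = RWKind.write → (v i).2 = 2)
    (hconst : ∀ v ∈ L, ∀ B g, ¬ ∀ i ≥ B, (v i).2 = g) :
    ¬ (network (scriptLeader T y).language L).Nonempty := by
  intro h
  obtain ⟨k, hk, x, hx, v, hv, ⟨ρ⟩⟩ := exists_netRun_of_network_nonempty h
  rw [mem_scriptLeader_language] at hx
  subst hx
  have hreg : ∀ t, ρ.reg t ≠ 2 := by
    intro t
    induction t with
    | zero =>
      intro ht
      by_cases hl : ρ.lead 0
      · have h1 := ρ.lead_val 0 hl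
        have h2 := ρ.lead_read 0 hl
        rw [Nat.count_zero] at h1 h2
        simp only [scriptWord] at h1 h2
        split_ifs at h1 h2 with h0
        · exact hy 0 h0 (h1.trans ht)
        · obtain ⟨s, hs, -⟩ := h2 rfl
          omega
      · obtain ⟨j, hj, -⟩ := ρ.covered 0 hl
        exact h2 _ (hv j) _ ((ρ.act_val j 0 hj).trans ht)
    | succ t ih =>
      intro ht
      by_cases hl : ρ.lead (t + 1)
      · have h1 := ρ.lead_val _ hl
        have h2 := ρ.lead_read _ hl
        simp only [scriptWord] at h1 h2
        split_ifs at h1 h2 with h0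
        · exact hy _ h0 (h1.trans ht)
        · obtain ⟨s, hs, hst⟩ := h2 rfl
          obtain rfl : t = s := by omega
          exact ih (hst.trans ht)
      · obtain ⟨j, hj, -⟩ := ρ.covered _ hl
        exact h2 _ (hv j) _ ((ρ.act_val j _ hj).trans ht)
  have hlead : ¬ ∃ᶠ t in atTop, ρ.lead t := by
    intro hfreq
    obtain ⟨t, ht, htT⟩ := exists_count_eq_of_frequently hfreq T
    apply hreg t
    rw [← ρ.lead_val t ht, htT]
    simp [scriptWord]
  obtain ⟨B, hB⟩ := eventually_atTop.1 (not_frequently.1 hlead)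
  have hstep : ∀ t ≥ B, ∃ j, ρ.act j t ∧ Held ρ.reg t := by
    intro t ht
    obtain ⟨j, hj, hj'⟩ := ρ.covered t (hB t ht)
    refine ⟨j, hj, hj' ?_⟩
    cases hkind : (v j (Nat.count (ρ.act j) t)).1 with
    | read => rfl
    | write => exact absurd (hwrite _ (hv j) _ hkind) (h2 _ (hv j) _)
  have hregB : ∀ t ≥ B, ρ.reg t = ρ.reg B := by
    intro t ht
    induction t, ht using Nat.le_induction with
    | base => rfl
    | succ t ht ih =>
      obtain ⟨-, -, s, hs, hst⟩ := hstep (t + 1) (by omega)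
      obtain rfl : t = s := by omega
      rw [← hst, ih]
  have : Nonempty (Fin k) := ⟨⟨0, hk⟩⟩
  choose! f hf using hstep
  obtain ⟨j, hj⟩ := exists_frequently_eq (eventually_ge_atTop B).frequently f
  have hfreq : ∃ᶠ t in atTop, ρ.act j t := hj.mono fun t ht => ht.2 ▸ (hf t ht.1).1
  refine hconst _ (hv j) (Nat.count (ρ.act j) B) (ρ.reg B) fun i hi => ?_
  obtain ⟨t, ht, rfl⟩ := exists_count_eq_of_frequently hfreq i
  rw [ρ.act_val j t ht]
  refine hregB t ?_
  by_contra hcon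
  have h1 := Nat.count_monotone (ρ.act j) (show t + 1 ≤ B by omega)
  rw [Nat.count_succ, if_pos ht] at h1
  omega

theorem le_of_restriction_nonempty {k M n m : ℕ} (hM : 2 ≤ M) (hk : 1 ≤ k) {T : ℕ}
    {y : ℕ → Fin 3} (hy : ∀ i < T, y i ≠ 2) {N : ℕ} (hN : 1 ≤ N)
    (h : (network (scriptLeader T y).language
      ((counterPDM k M n m).restriction N hN).language).Nonempty) :
    ((M - 1) * k + 1) * k ≤ N := by
  by_contra hlt
  have h2 : ∀ v ∈ ((counterPDM k M n m).restriction N hN).language, ∀ i, (v i).2 ≠ 2 :=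
    fun v hv => counterPDM_restriction_val_ne hM hk hN (by omega) hv
  exact network_scriptLeader_not_nonempty hy h2
    (fun v hv => counterPDM_write (PDM.restriction_language_subset hv))
    (fun v hv => counterPDM_not_eventually_const hM hk (PDM.restriction_language_subset hv)
      (h2 v hv)) h

end Leader

theorem mainTheorem4 :
    (∀ {G QD ΓD QC ΓC : Type*} [Finite G] [Finite QD] [Finite ΓD] [Finite QC] [Finite ΓC]
        (D : BuchiPDM QD ΓD (RW G)) (C : PDM QC ΓC (RW G)),
      (network D.language C.language).Nonempty ↔
        (network D.language (C.restriction (2 * Nat.card QC ^ 2 * Nat.card ΓC + 1)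
          (Nat.le_add_left 1 _)).language).Nonempty) ∧
    (∃ c : ℝ, 0 < c ∧ ∃ n₀ : ℕ, ∀ n m : ℕ, n₀ ≤ n → n₀ ≤ m →
      ∃ (g d e : ℕ) (D : BuchiPDM (Fin d) (Fin e) (RW (Fin g)))
        (C : PDM (Fin n) (Fin m) (RW (Fin g))),
        D.accepting = Set.univ ∧
        (∀ x : Fin g, ∃ v ∈ D.language ∪ C.language, ∃ i : ℕ, (v i).2 = x) ∧
        ∀ (N : ℕ) (hN : 1 ≤ N),
          ((network D.language C.language).Nonempty ↔
            (network D.language (C.restriction N hN).language).Nonempty) →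
          c * (n : ℝ) ^ 2 * (m : ℝ) ≤ (N : ℝ)) := by
  refine ⟨fun D C => network_nonempty_iff_restriction D C, 1 / 32, by norm_num, 6, ?_⟩
  intro n m hn hm
  obtain ⟨n, rfl⟩ := Nat.exists_eq_add_of_le' (show 1 ≤ n by omega)
  obtain ⟨m, rfl⟩ := Nat.exists_eq_add_of_le' (show 1 ≤ m by omega)
  -- `k` states for pushing and `k` states for popping
  obtain ⟨k, hk⟩ : ∃ k, k = (n - 1) / 2 := ⟨_, rfl⟩
  obtain ⟨v, hv, T, hvT, hT, hT', ⟨i₀, hi₀⟩, i₁, hi₁⟩ :=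
    exists_counterPDM_word (k := k) (M := m) (n := n) (m := m) (by omega) (by omega) (by omega)
      le_rfl
  refine ⟨3, T + 1, 2, scriptLeader T fun i => (v i).2, counterPDM k m n m, rfl, ?_, ?_⟩
  · intro x
    refine ⟨v, .inr hv, ?_⟩
    fin_cases x
    · exact ⟨i₀, hi₀⟩
    · exact ⟨i₁, hi₁⟩
    · exact ⟨T, by rw [hT]; rfl⟩
  · intro N hN hiff
    have h := le_of_restriction_nonempty (by omega) (by omega) hvT hN
      (hiff.1 (network_scriptLeader_nonempty hv hT hT'))
    -- these two estimates give the constant `1 / 32`; sizes of at least `6` suffice for them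
    have h1 : (n + 1 : ℝ) ≤ 4 * k := by exact_mod_cast (show n + 1 ≤ 4 * k by omega)
    have h2 : (m + 1 : ℝ) ≤ 2 * ((m - 1 : ℕ) : ℝ) := by
      exact_mod_cast (show m + 1 ≤ 2 * (m - 1) by omega)
    have h3 : (((m - 1 : ℕ) : ℝ) * k + 1) * k ≤ N := by exact_mod_cast h
    push_cast
    calc 1 / 32 * (n + 1 : ℝ) ^ 2 * (m + 1)
        ≤ 1 / 32 * (4 * k) ^ 2 * (2 * ((m - 1 : ℕ) : ℝ)) := by gcongr
      _ = ((m - 1 : ℕ) : ℝ) * k * k := by ring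
      _ ≤ (((m - 1 : ℕ) : ℝ) * k + 1) * k := by gcongr; linarith
      _ ≤ N := h3
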